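/- For integers $b\ge 2$, $0<d<b$ and $k\ge 0$, let $I(b,d,k)=\sum 1/m$, the sum being over the positive integers $m$ whose base-$b$ representation contains the digit $d$ exactly $k$ times. Fix integers $d>0$ and $k\ge 3$. The series $I(b,d,k)$ converges for every integer $b>d$, and as $b\to\infty$ (through the integers, with $d$ and $k$ fixed) $I(b,d,k)-b\log b$ has an asymptotic expansion to all orders in inverse powers of $b$, starting at $b^{-2k+1}$: there are real numbers $a_1,a_2,a_3,\dots$, depending only on $d$ and $k$, such that for every integer $N\ge 0$ $$I(b,d,k)=b\log b+\sum_{n=1}^{N}\frac{a_n}{b^{2k-2+n}}+O\bigl(b^{-(2k-1+N)}\bigr),$$ where the implied constant may depend on $d$, $k$ and $N$. In particular $$I(b,d,k)=b\log b+\frac{a_1}{b^{2k-1}}+\frac{a_2}{b^{2k}}+\frac{a_3}{b^{2k+1}}+\frac{a_4}{b^{2k+2}}+O(b^{-2k-3}).$$ The first four coefficients are $$a_1=\frac{d+\frac12}{d^2},\qquad a_2=\frac{(d+\frac12)\bigl((k-2)d+k-3\bigr)}{d^2(d+1)},$$ $$a_3=(d+\tfrac12)\zeta(2)+(d+\tfrac12)\,\frac{(k^2-5k+4)d^3+(2k^2-12k+8)d^2+(k^2-7k+1)d-2}{2d^3(d+1)^2},$$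 $$a_4=(d+\tfrac12)\left(-2d\,\zeta(3)+k\,\zeta(2)+\frac{P_k(d)}{6d^4(d+1)^3}\right)+\varepsilon_k(d),$$ where $$P_k(d)=(k^3-9k^2+14k)d^5+(3k^3-30k^2+45k+42)d^4+(3k^3-33k^2+39k+114)d^3+(k^3-12k^2+2k+108)d^2+(-6k+43)d+6,$$ $\varepsilon_k(d)=0$ for $k\ge4$, and $\varepsilon_3(d)=(d^2-\frac13)/d^3$. Explicitly, for $k=3$, $$a_4=-(2d+1)d\,\zeta(3)+3(d+\tfrac12)\zeta(2)-\frac{12d^6-50d^4-81d^3-71d^2-33d-6}{12d^4(d+1)^3}.$$ -/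

import Mathlib

open Filter Asymptotics

/-- The positive integers whose base `b` representation contains the digit `d` exactly `k` times. -/
def irwinSet (b d k : ℕ) : Set ℕ :=
  {m : ℕ | 0 < m ∧ (Nat.digits b m).count d = k}

/-- The Irwin harmonic sum `I(b,d,k)`: the sum of `1/m` over the positive integers `m` whose
base `b` representation contains the digit `d` exactly `k` times. -/
noncomputable def irwinSum (b d k : ℕ) : ℝ :=
  ∑' m : irwinSet b d k, 1 / ((m : ℕ) : ℝ)

/-- The real value `ζ(n)` of the Riemann zeta function (real-valued at the integers `n ≥ 2`). -/
noncomputable def zetaVal (n : ℕ) : ℝ := (riemannZeta (n : ℂ)).re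

/-! Split a positive integer m with at least two digits as m = n b^l + j, where b ≤ n < b^2 carries
the two leading digits and j < b^l. Then 1/m = b^(-l) / (n + j/b^l), so I(b,d,k) is the sum over n
of the integrals of 1/(n + x) against a measure μ_K on [0,1). Here K is k + 1 minus the number of
digits d in n, and μ_K puts mass b^(-l) at j/b^l, for all l and all j < b^l with K - 1 digits d
(`irwinMean`). One-digit integers drop out because k ≥ 2.

For K ≥ 1 the measure μ_K has total mass exactly b (`hasSum_irwinBlock_one`) and is close to b times
Lebesgue measure. Lebesgue measure itself contributes the telescoping sum of b (log(n + 1) - log n),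
which is b log b. Expanding 1/(n + x) in powers of 1/n leaves an alternating sum of n^(-j-1) times
the deviations of the j-th moments (`abs_irwinSum_sub_le`); j = 0 gives nothing because the mass is
exact.

Stripping the first digit makes the μ_K self-similar, so their moments obey a linear recurrence in K
and m. Since b times Lebesgue measure solves the same recurrence, so do the deviations
(`irwinDeviation_succ`), starting at K = 0 from -b/(m + 1). Hence the deviations at level K are
b^(1-2K) times a full expansion in 1/b (`exists_hasInvPowExpansion_scaledDeviation`).

Only the levels k - 1, k, k + 1 occur: the first for the single corner n = d b + d, the second for
the row and column where exactly one leading digit is d, the third elsewhere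
(`sum_Ico_irwinDeviation`). Sums of n^(-s) over runs of consecutive n expand by an Euler–Maclaurin
argument on zeta tails (`isBigO_scaledZetaTail_sub`), while the column n = c b + d produces zeta
values (`invPowApprox_col`). The corner with j = 1 dominates and has order b^(-2) b^(1-2(k-1)) =
b^(-2k+1). The exceptional term at k = 3 appears because the fourth coefficient depends on the
second moment at level k - 2, which for k = 3 is fed directly by the initial level 0. -/

open scoped Topology

/-! ### Asymptotic expansions in powers of 1/b -/

/-- A polynomial divisible by `X ^ N` is `O(x ^ N)` on the unit interval. -/
theorem Polynomial.exists_abs_eval_le_of_X_pow_dvd {R : Polynomial ℝ} {N : ℕ}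
    (h : Polynomial.X ^ N ∣ R) :
    ∃ C : ℝ, ∀ x ∈ Set.Icc (0 : ℝ) 1, |R.eval x| ≤ C * x ^ N := by
  obtain ⟨S, rfl⟩ := h
  obtain ⟨C, hC⟩ := isCompact_Icc.exists_bound_of_continuousOn (s := Set.Icc (0 : ℝ) 1)
    (f := fun x => S.eval x) S.continuous.continuousOn
  refine ⟨C, fun x hx => ?_⟩
  have h1 := hC x hx
  rw [Real.norm_eq_abs] at h1
  rw [Polynomial.eval_mul, Polynomial.eval_pow, Polynomial.eval_X, abs_mul, abs_pow,
    abs_of_nonneg hx.1, mul_comm]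
  exact mul_le_mul_of_nonneg_right h1 (pow_nonneg hx.1 _)

theorem PowerSeries.eval_trunc_eq_sum (p : PowerSeries ℝ) (N : ℕ) (x : ℝ) :
    (PowerSeries.trunc N p).eval x = ∑ n ∈ Finset.range N, PowerSeries.coeff n p * x ^ n := by
  have := PowerSeries.eval₂_trunc_eq_sum_range x (RingHom.id ℝ) N p
  simpa [Polynomial.eval₂_id] using this

/-- `f b` agrees with the series `p`, evaluated at `1 / b`, up to `O(b ^ (-N))`. -/
def InvPowApprox (N : ℕ) (f : ℕ → ℝ) (p : PowerSeries ℝ) : Prop :=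
  (fun b : ℕ => f b - (PowerSeries.trunc N p).eval (b : ℝ)⁻¹) =O[atTop]
    (fun b : ℕ => ((b : ℝ)⁻¹) ^ N)

/-- `f b` has the asymptotic expansion `p` in powers of `1 / b`, to all orders. -/
def HasInvPowExpansion (f : ℕ → ℝ) (p : PowerSeries ℝ) : Prop :=
  ∀ N, InvPowApprox N f p

theorem natCast_inv_mem_Icc (b : ℕ) : ((b : ℝ)⁻¹) ∈ Set.Icc (0 : ℝ) 1 :=
  ⟨by positivity, Nat.cast_inv_le_one b⟩

theorem isBigO_inv_pow_of_le {M N : ℕ} (h : M ≤ N) :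
    (fun b : ℕ => ((b : ℝ)⁻¹) ^ N) =O[atTop] (fun b : ℕ => ((b : ℝ)⁻¹) ^ M) := by
  refine IsBigO.of_bound 1 (Eventually.of_forall fun b => ?_)
  have hb := natCast_inv_mem_Icc b
  rw [one_mul, norm_pow, norm_pow]
  exact pow_le_pow_of_le_one (norm_nonneg _) (by rw [Real.norm_of_nonneg hb.1]; exact hb.2) h

theorem isBigO_eval_inv_of_X_pow_dvd {R : Polynomial ℝ} {N : ℕ} (h : Polynomial.X ^ N ∣ R) :
    (fun b : ℕ => R.eval (b : ℝ)⁻¹) =O[atTop] (fun b : ℕ => ((b : ℝ)⁻¹) ^ N) := by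
  obtain ⟨C, hC⟩ := Polynomial.exists_abs_eval_le_of_X_pow_dvd h
  refine IsBigO.of_bound C (Eventually.of_forall fun b => ?_)
  have hb := natCast_inv_mem_Icc b
  rw [Real.norm_eq_abs, Real.norm_of_nonneg (pow_nonneg hb.1 _)]
  exact hC _ hb

theorem isBigO_eval_inv_one (R : Polynomial ℝ) :
    (fun b : ℕ => R.eval (b : ℝ)⁻¹) =O[atTop] (fun _ : ℕ => (1 : ℝ)) := by
  simpa using isBigO_eval_inv_of_X_pow_dvd (N := 0) (R := R) (by simp)

namespace InvPowApprox

variable {N M : ℕ} {f g : ℕ → ℝ} {p q : PowerSeries ℝ}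

theorem congr_fun' (hf : InvPowApprox N f p) (h : f =ᶠ[atTop] g) : InvPowApprox N g p :=
  IsBigO.congr' hf (h.mono fun b hb => by simp only [hb]) EventuallyEq.rfl

theorem congr_series (hf : InvPowApprox N f p)
    (h : ∀ n < N, PowerSeries.coeff n p = PowerSeries.coeff n q) : InvPowApprox N f q := by
  have : PowerSeries.trunc N p = PowerSeries.trunc N q := by
    ext n
    simp only [PowerSeries.coeff_trunc]
    split_ifs with hn
    · exact h n hn
    · rfl
  rw [InvPowApprox, ← this]
  exact hf

theorem mono (hf : InvPowApprox N f p) (h : M ≤ N) : InvPowApprox M f p := by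
  have h1 : Polynomial.X ^ M ∣ PowerSeries.trunc N p - PowerSeries.trunc M p := by
    rw [Polynomial.X_pow_dvd_iff]
    intro n hn
    simp [PowerSeries.coeff_trunc, hn, hn.trans_le h]
  refine ((hf.trans (isBigO_inv_pow_of_le h)).add (isBigO_eval_inv_of_X_pow_dvd h1)).congr_left
    fun b => ?_
  rw [Polynomial.eval_sub]; ring

theorem zero_iff : InvPowApprox N f 0 ↔ f =O[atTop] (fun b : ℕ => ((b : ℝ)⁻¹) ^ N) := by
  simp [InvPowApprox]

theorem add (hf : InvPowApprox N f p) (hg : InvPowApprox N g q) :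
    InvPowApprox N (fun b => f b + g b) (p + q) := by
  refine (IsBigO.add hf hg).congr_left fun b => ?_
  rw [map_add, Polynomial.eval_add]; ring

theorem isBigO_one (hf : InvPowApprox N f p) : f =O[atTop] (fun _ : ℕ => (1 : ℝ)) := by
  have h1 : (fun b : ℕ => ((b : ℝ)⁻¹) ^ N) =O[atTop] (fun _ : ℕ => (1 : ℝ)) := by
    simpa using isBigO_inv_pow_of_le (Nat.zero_le N)
  refine ((hf.trans h1).add (isBigO_eval_inv_one (PowerSeries.trunc N p))).congr_left fun b => ?_
  ring

theorem mul (hf : InvPowApprox N f p) (hg : InvPowApprox N g q) :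
    InvPowApprox N (fun b => f b * g b) (p * q) := by
  have h1 : Polynomial.X ^ N ∣
      PowerSeries.trunc N p * PowerSeries.trunc N q - PowerSeries.trunc N (p * q) := by
    rw [Polynomial.X_pow_dvd_iff]
    intro n hn
    have := congrArg (fun P : Polynomial ℝ => P.coeff n)
      (PowerSeries.trunc_trunc_mul_trunc (n := N) p q)
    simp only [PowerSeries.coeff_trunc, hn, if_true] at this
    rw [Polynomial.coeff_sub, PowerSeries.coeff_trunc, if_pos hn, ← this, ← Polynomial.coe_mul,
      Polynomial.coeff_coe, sub_self]
  have h2 : (fun b : ℕ => (f b - (PowerSeries.trunc N p).eval (b : ℝ)⁻¹) * g b) =O[atTop]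
      (fun b : ℕ => ((b : ℝ)⁻¹) ^ N * 1) := IsBigO.mul hf hg.isBigO_one
  have h3 : (fun b : ℕ => (PowerSeries.trunc N p).eval (b : ℝ)⁻¹ *
      (g b - (PowerSeries.trunc N q).eval (b : ℝ)⁻¹)) =O[atTop]
      (fun b : ℕ => 1 * ((b : ℝ)⁻¹) ^ N) := (isBigO_eval_inv_one _).mul hg
  simp only [mul_one, one_mul] at h2 h3
  refine ((h2.add h3).add (isBigO_eval_inv_of_X_pow_dvd h1)).congr_left fun b => ?_
  rw [Polynomial.eval_sub, Polynomial.eval_mul]; ring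

theorem polynomial (P : Polynomial ℝ) (N : ℕ) :
    InvPowApprox N (fun b => P.eval (b : ℝ)⁻¹) (P : PowerSeries ℝ) := by
  have h1 : Polynomial.X ^ N ∣ P - PowerSeries.trunc N (P : PowerSeries ℝ) := by
    rw [Polynomial.X_pow_dvd_iff]
    intro n hn
    simp [PowerSeries.coeff_trunc, hn]
  refine (isBigO_eval_inv_of_X_pow_dvd h1).congr_left fun b => ?_
  rw [Polynomial.eval_sub]

theorem sum {ι : Type*} {s : Finset ι} {f : ι → ℕ → ℝ} {p : ι → PowerSeries ℝ}
    (h : ∀ i ∈ s, InvPowApprox N (f i) (p i)) :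
    InvPowApprox N (fun b => ∑ i ∈ s, f i b) (∑ i ∈ s, p i) := by
  refine (IsBigO.sum h).congr_left fun b => ?_
  rw [map_sum, Polynomial.eval_finsetSum, Finset.sum_apply, Finset.sum_sub_distrib]

/-- A factor b^(-i) gains i orders of accuracy. This gain drives the induction on the order for zeta
tails. -/
theorem X_pow_mul (i : ℕ) (hf : InvPowApprox N f p) :
    InvPowApprox (i + N) (fun b => ((b : ℝ)⁻¹) ^ i * f b) (PowerSeries.X ^ i * p) := by
  have h2 : (fun b : ℕ => ((b : ℝ)⁻¹) ^ i * (f b - (PowerSeries.trunc N p).eval (b : ℝ)⁻¹))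
      =O[atTop] (fun b : ℕ => ((b : ℝ)⁻¹) ^ i * ((b : ℝ)⁻¹) ^ N) := (isBigO_refl _ _).mul hf
  have h3 : PowerSeries.trunc (i + N) (PowerSeries.X ^ i * p)
      = Polynomial.X ^ i * PowerSeries.trunc N p := by
    ext n
    rw [Polynomial.coeff_X_pow_mul', PowerSeries.coeff_trunc, PowerSeries.coeff_X_pow_mul']
    split_ifs with h1 h2
    · rw [PowerSeries.coeff_trunc, if_pos (by omega)]
    · rfl
    · rw [PowerSeries.coeff_trunc, if_neg (by omega)]
    · rfl
  rw [InvPowApprox, h3]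
  refine h2.congr (fun b => ?_) fun b => (pow_add _ _ _).symm
  rw [Polynomial.eval_mul, Polynomial.eval_pow, Polynomial.eval_X]; ring

/-- Each coefficient is recovered as a limit once the earlier terms are subtracted, which is why
expansions are unique. -/
theorem tendsto_mul_pow {n : ℕ} (hf : InvPowApprox N f p) (hn : n < N) :
    Tendsto (fun b : ℕ => (f b - (PowerSeries.trunc n p).eval (b : ℝ)⁻¹) * (b : ℝ) ^ n) atTop
      (𝓝 (PowerSeries.coeff n p)) := by
  have h1 := hf.mono (Nat.succ_le_of_lt hn)
  have h2 : (fun b : ℕ => (f b - (PowerSeries.trunc (n + 1) p).eval (b : ℝ)⁻¹) * (b : ℝ) ^ n)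
      =O[atTop] (fun b : ℕ => ((b : ℝ)⁻¹) ^ (n + 1) * (b : ℝ) ^ n) := IsBigO.mul h1 (isBigO_refl _ _)
  have h3 : (fun b : ℕ => ((b : ℝ)⁻¹) ^ (n + 1) * (b : ℝ) ^ n) =ᶠ[atTop]
      fun b : ℕ => (b : ℝ)⁻¹ := by
    filter_upwards [eventually_gt_atTop 0] with b hb
    have h0 : ((b : ℝ)⁻¹) ^ n * (b : ℝ) ^ n = 1 := by
      rw [← mul_pow, inv_mul_cancel₀ (by positivity), one_pow]
    rw [pow_succ, mul_right_comm, h0, one_mul]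
  have h4 := (h2.trans_eventuallyEq h3).trans_tendsto tendsto_inv_atTop_nhds_zero_nat
  have h5 := h4.add_const (PowerSeries.coeff n p)
  rw [zero_add] at h5
  refine h5.congr' ?_
  filter_upwards [eventually_gt_atTop 0] with b hb
  have h0 : ((b : ℝ)⁻¹) ^ n * (b : ℝ) ^ n = 1 := by
    rw [← mul_pow, inv_mul_cancel₀ (by positivity), one_pow]
  rw [PowerSeries.eval_trunc_eq_sum, PowerSeries.eval_trunc_eq_sum, Finset.sum_range_succ]
  linear_combination -PowerSeries.coeff n p * h0

theorem coeff_eq (hf : InvPowApprox N f p) (hg : InvPowApprox N f q) :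
    ∀ n < N, PowerSeries.coeff n p = PowerSeries.coeff n q := by
  intro n
  induction n using Nat.strong_induction_on with
  | _ n ih =>
    intro hn
    have h1 : PowerSeries.trunc n p = PowerSeries.trunc n q := by
      ext m
      simp only [PowerSeries.coeff_trunc]
      split_ifs with hm
      · exact ih m hm (hm.trans hn)
      · rfl
    have h2 := hf.tendsto_mul_pow hn
    rw [h1] at h2
    exact tendsto_nhds_unique h2 (hg.tendsto_mul_pow hn)

end InvPowApprox

namespace HasInvPowExpansion

variable {f g : ℕ → ℝ} {p q : PowerSeries ℝ}

theorem congr_fun' (hf : HasInvPowExpansion f p) (h : f =ᶠ[atTop] g) : HasInvPowExpansion g p :=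
  fun N => (hf N).congr_fun' h

theorem add (hf : HasInvPowExpansion f p) (hg : HasInvPowExpansion g q) :
    HasInvPowExpansion (fun b => f b + g b) (p + q) := fun N => (hf N).add (hg N)

theorem mul (hf : HasInvPowExpansion f p) (hg : HasInvPowExpansion g q) :
    HasInvPowExpansion (fun b => f b * g b) (p * q) := fun N => (hf N).mul (hg N)

theorem sum {ι : Type*} {s : Finset ι} {f : ι → ℕ → ℝ} {p : ι → PowerSeries ℝ}
    (h : ∀ i ∈ s, HasInvPowExpansion (f i) (p i)) :
    HasInvPowExpansion (fun b => ∑ i ∈ s, f i b) (∑ i ∈ s, p i) :=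
  fun N => InvPowApprox.sum fun i hi => h i hi N

theorem polynomial (P : Polynomial ℝ) :
    HasInvPowExpansion (fun b => P.eval (b : ℝ)⁻¹) (P : PowerSeries ℝ) :=
  fun N => InvPowApprox.polynomial P N

theorem const (c : ℝ) : HasInvPowExpansion (fun _ => c) (PowerSeries.C c) := by
  simpa using polynomial (Polynomial.C c)

theorem inv_pow (i : ℕ) : HasInvPowExpansion (fun b => ((b : ℝ)⁻¹) ^ i) (PowerSeries.X ^ i) := by
  simpa using polynomial (Polynomial.X ^ i)

theorem const_mul (c : ℝ) (hf : HasInvPowExpansion f p) :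
    HasInvPowExpansion (fun b => c * f b) (PowerSeries.C c * p) := (const c).mul hf

theorem inv_pow_mul (i : ℕ) (hf : HasInvPowExpansion f p) :
    HasInvPowExpansion (fun b => ((b : ℝ)⁻¹) ^ i * f b) (PowerSeries.X ^ i * p) :=
  (inv_pow i).mul hf

theorem neg (hf : HasInvPowExpansion f p) : HasInvPowExpansion (fun b => -f b) (-p) := by
  simpa using hf.const_mul (-1)

theorem sub (hf : HasInvPowExpansion f p) (hg : HasInvPowExpansion g q) :
    HasInvPowExpansion (fun b => f b - g b) (p - q) := by
  simpa only [sub_eq_add_neg] using hf.add hg.neg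

theorem pow (hf : HasInvPowExpansion f p) (i : ℕ) :
    HasInvPowExpansion (fun b => f b ^ i) (p ^ i) := by
  induction i with
  | zero => simpa using const 1
  | succ i ih => simpa only [pow_succ] using ih.mul hf

theorem unique (hf : HasInvPowExpansion f p) (hg : HasInvPowExpansion f q) : p = q := by
  ext n
  exact (hf (n + 1)).coeff_eq (hg (n + 1)) n n.lt_succ_self

theorem tendsto (hf : HasInvPowExpansion f p) :
    Tendsto f atTop (𝓝 (PowerSeries.coeff 0 p)) := by
  simpa using (hf 1).tendsto_mul_pow zero_lt_one

/-- If T is the truncation of the inverse series, then f T - 1 is small of order N, and 1/f - T =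
-(1/f)(f T - 1). The factor 1/f is bounded because f tends to the nonzero constant coefficient. -/
theorem inv (hf : HasInvPowExpansion f p) (h0 : PowerSeries.constantCoeff p ≠ 0) :
    HasInvPowExpansion (fun b => (f b)⁻¹) p⁻¹ := by
  intro N
  have h1 : InvPowApprox N (fun b => f b * (PowerSeries.trunc N p⁻¹).eval (b : ℝ)⁻¹ - 1) 0 := by
    have h2 := ((hf N).mul (InvPowApprox.polynomial (PowerSeries.trunc N p⁻¹) N)).add
      (const (-1) N)
    refine (h2.congr_series fun n hn => ?_).congr_fun' (Eventually.of_forall fun b => by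
      simp only [sub_eq_add_neg])
    have h3 := congrArg (fun P : Polynomial ℝ => P.coeff n)
      (PowerSeries.trunc_trunc_mul (n := N) p⁻¹ p)
    simp only [PowerSeries.coeff_trunc, hn, if_true] at h3
    rw [map_add, mul_comm, h3, PowerSeries.inv_mul_cancel _ h0, ← map_one PowerSeries.C,
      ← map_add, ← map_add]
    norm_num
  have h0' : PowerSeries.coeff 0 p ≠ 0 := by simpa using h0
  have h2 : Tendsto (fun b => (f b)⁻¹) atTop (𝓝 (PowerSeries.coeff 0 p)⁻¹) := hf.tendsto.inv₀ h0'
  have h3 := ((h2.isBigO_one ℝ).mul (InvPowApprox.zero_iff.1 h1)).neg_left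
  refine h3.congr' ?_ (Eventually.of_forall fun b => one_mul _)
  filter_upwards [hf.tendsto.eventually_ne h0'] with b hb
  field_simp
  ring

/-- Approximations to every order, by series that may depend on the order, patch together. -/
theorem exists_of_forall (h : ∀ N, ∃ p, InvPowApprox N f p) : ∃ p, HasInvPowExpansion f p := by
  choose P hP using h
  refine ⟨PowerSeries.mk fun n => PowerSeries.coeff n (P (n + 1)), fun N => ?_⟩
  refine (hP N).congr_series fun n hn => ?_
  rw [PowerSeries.coeff_mk]
  exact ((hP N).mono hn).coeff_eq (hP (n + 1)) n n.lt_succ_self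

theorem comp_const_mul (hf : HasInvPowExpansion f p) {c : ℕ} (hc : 0 < c) :
    HasInvPowExpansion (fun b => f (c * b)) (PowerSeries.rescale ((c : ℝ)⁻¹) p) := by
  intro N
  have h1 : Tendsto (fun b : ℕ => c * b) atTop atTop := tendsto_id.const_mul_atTop' hc
  have h2 := (hf N).comp_tendsto h1
  refine (h2.trans (IsBigO.of_bound ‖((c : ℝ)⁻¹) ^ N‖ (Eventually.of_forall fun b => ?_))).congr_left
    fun b => ?_
  · simp only [Function.comp, Nat.cast_mul, mul_inv, mul_pow, norm_mul]
    exact le_rfl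
  · simp only [Function.comp, PowerSeries.eval_trunc_eq_sum, PowerSeries.coeff_rescale,
      Nat.cast_mul, mul_inv, mul_pow]
    congr 1
    exact Finset.sum_congr rfl fun n _ => by ring

/-- Existence suffices: the expansion at b^2 serves only for the upper end of the sum over n < b^2,
which does not reach the first four coefficients. -/
theorem exists_comp_sq (hf : HasInvPowExpansion f p) :
    ∃ q, HasInvPowExpansion (fun b => f (b ^ 2)) q := by
  refine exists_of_forall fun N => ?_
  have h1 : Tendsto (fun b : ℕ => b ^ 2) atTop atTop := tendsto_pow_atTop two_ne_zero
  have h2 := (hf N).comp_tendsto h1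
  have h3 : InvPowApprox N (fun b => f (b ^ 2) -
      ((PowerSeries.trunc N p).comp (Polynomial.X ^ 2)).eval (b : ℝ)⁻¹) 0 := by
    rw [InvPowApprox.zero_iff]
    refine (h2.congr (fun b => ?_) (fun b => ?_)).trans
      (isBigO_inv_pow_of_le (show N ≤ 2 * N by omega))
    · simp [Function.comp]
    · simp [Function.comp, pow_mul]
  refine ⟨_, (h3.add (InvPowApprox.polynomial ((PowerSeries.trunc N p).comp
    (Polynomial.X ^ 2)) N)).congr_fun' (Eventually.of_forall fun b => ?_)⟩
  simp

end HasInvPowExpansion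

/-! ### The binomial series with negative exponent -/

/-- The binomial series of `(1 + X) ^ (-r)`. -/
noncomputable def negBinomSeries (r : ℕ) : PowerSeries ℝ := ((1 + PowerSeries.X) ^ r)⁻¹

theorem negBinomSeries_mul (r : ℕ) :
    negBinomSeries r * (1 + PowerSeries.X) ^ r = 1 :=
  PowerSeries.inv_mul_cancel _ (by simp)

theorem negBinomSeries_zero : negBinomSeries 0 = 1 := by
  simpa using negBinomSeries_mul 0

theorem negBinomSeries_succ_mul (r : ℕ) :
    negBinomSeries (r + 1) * (1 + PowerSeries.X) = negBinomSeries r := by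
  have h1 := negBinomSeries_mul r
  have h2 := negBinomSeries_mul (r + 1)
  calc negBinomSeries (r + 1) * (1 + PowerSeries.X)
      = negBinomSeries (r + 1) * (1 + PowerSeries.X) *
        (negBinomSeries r * (1 + PowerSeries.X) ^ r) := by rw [h1, mul_one]
    _ = negBinomSeries r * (negBinomSeries (r + 1) * (1 + PowerSeries.X) ^ (r + 1)) := by ring
    _ = negBinomSeries r := by rw [h2, mul_one]

theorem coeff_zero_negBinomSeries (r : ℕ) : PowerSeries.coeff 0 (negBinomSeries r) = 1 := by
  simp [negBinomSeries]

/-- A Pascal rule read off from multiplying by 1 + X; it yields the closed forms of the low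
coefficients by induction on `r`. -/
theorem coeff_succ_negBinomSeries_succ (r n : ℕ) :
    PowerSeries.coeff (n + 1) (negBinomSeries (r + 1)) =
      PowerSeries.coeff (n + 1) (negBinomSeries r) -
        PowerSeries.coeff n (negBinomSeries (r + 1)) := by
  rw [← negBinomSeries_succ_mul r, mul_add, mul_one, map_add, PowerSeries.coeff_succ_mul_X]
  ring

theorem coeff_one_negBinomSeries (r : ℕ) : PowerSeries.coeff 1 (negBinomSeries r) = -r := by
  induction r with
  | zero => simp [negBinomSeries_zero, PowerSeries.coeff_one]
  | succ r ih =>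
    rw [coeff_succ_negBinomSeries_succ, zero_add, ih, coeff_zero_negBinomSeries]
    push_cast; ring

theorem coeff_two_negBinomSeries (r : ℕ) :
    PowerSeries.coeff 2 (negBinomSeries r) = r * (r + 1) / 2 := by
  induction r with
  | zero => simp [negBinomSeries_zero, PowerSeries.coeff_one]
  | succ r ih =>
    rw [coeff_succ_negBinomSeries_succ, one_add_one_eq_two, ih, coeff_one_negBinomSeries]
    push_cast; ring

theorem coeff_three_negBinomSeries (r : ℕ) :
    PowerSeries.coeff 3 (negBinomSeries r) = -(r * (r + 1) * (r + 2) / 6) := by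
  induction r with
  | zero => simp [negBinomSeries_zero, PowerSeries.coeff_one]
  | succ r ih =>
    rw [coeff_succ_negBinomSeries_succ, two_add_one_eq_three, ih, coeff_two_negBinomSeries]
    push_cast; ring

theorem hasInvPowExpansion_one_add_inv_pow_inv (r : ℕ) :
    HasInvPowExpansion (fun b => ((1 + (b : ℝ)⁻¹) ^ r)⁻¹) (negBinomSeries r) := by
  refine HasInvPowExpansion.inv ?_ (by simp)
  have h1 : HasInvPowExpansion (fun b => 1 + (b : ℝ)⁻¹) (1 + PowerSeries.X) := by
    simpa using (HasInvPowExpansion.const 1).add (HasInvPowExpansion.inv_pow 1)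
  exact h1.pow r

/-- Taylor expansion of `(1 + x) ^ (-r)`, with a remainder that is uniform on `[0, 1]`. -/
theorem exists_abs_one_add_pow_inv_sub_le (r N : ℕ) :
    ∃ C : ℝ, ∀ x ∈ Set.Icc (0 : ℝ) 1,
      |((1 + x) ^ r)⁻¹ - (PowerSeries.trunc N (negBinomSeries r)).eval x| ≤ C * x ^ N := by
  have h1 : Polynomial.X ^ N ∣
      PowerSeries.trunc N (negBinomSeries r) * (1 + Polynomial.X) ^ r - 1 := by
    rw [Polynomial.X_pow_dvd_iff]
    intro n hn
    have := congrArg (fun P : Polynomial ℝ => P.coeff n)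
      (PowerSeries.trunc_trunc_mul (n := N) (negBinomSeries r) ((1 + PowerSeries.X) ^ r))
    simp only [PowerSeries.coeff_trunc, hn, if_true, negBinomSeries_mul] at this
    rw [Polynomial.coeff_sub, ← Polynomial.coeff_coe, ← Polynomial.coeff_coe (1 : Polynomial ℝ)]
    push_cast
    rw [this, sub_self]
  obtain ⟨C, hC⟩ := Polynomial.exists_abs_eval_le_of_X_pow_dvd h1
  refine ⟨C, fun x hx => ?_⟩
  have h2 := hC x hx
  simp only [Polynomial.eval_sub, Polynomial.eval_mul, Polynomial.eval_pow, Polynomial.eval_add,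
    Polynomial.eval_one, Polynomial.eval_X] at h2
  have h3 : 1 ≤ (1 + x) ^ r := one_le_pow₀ (by linarith [hx.1])
  have h4 : ((1 + x) ^ r)⁻¹ - (PowerSeries.trunc N (negBinomSeries r)).eval x =
      -(((PowerSeries.trunc N (negBinomSeries r)).eval x * (1 + x) ^ r - 1) * ((1 + x) ^ r)⁻¹) := by
    field_simp
    ring
  rw [h4, abs_neg, abs_mul, abs_of_nonneg (a := ((1 + x) ^ r)⁻¹) (by positivity)]
  exact (mul_le_of_le_one_right (abs_nonneg _) (inv_le_one_of_one_le₀ h3)).trans h2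

/-! ### Tails of the zeta series and their expansions -/

/-- The tail `∑_{i ≥ n} i ^ (-s)` of the zeta series. -/
noncomputable def zetaTail (s n : ℕ) : ℝ := ∑' i : ℕ, (((n + i : ℕ) : ℝ)⁻¹) ^ s

theorem summable_inv_pow_shift {s : ℕ} (hs : 2 ≤ s) (n : ℕ) :
    Summable fun i : ℕ => (((n + i : ℕ) : ℝ)⁻¹) ^ s := by
  have h1 : Summable fun i : ℕ => ((i : ℝ)⁻¹) ^ s := by
    simpa using Real.summable_nat_pow_inv.2 (by omega : 1 < s)
  have h2 := (summable_nat_add_iff n).2 h1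
  simpa only [add_comm n] using h2

theorem sum_Ico_inv_pow_eq_zetaTail_sub {s : ℕ} (hs : 2 ≤ s) {n m : ℕ} (h : n ≤ m) :
    ∑ i ∈ Finset.Ico n m, ((i : ℝ)⁻¹) ^ s = zetaTail s n - zetaTail s m := by
  have h1 := (summable_inv_pow_shift hs n).sum_add_tsum_nat_add (m - n)
  rw [Finset.sum_Ico_eq_sum_range, eq_sub_iff_add_eq, zetaTail, zetaTail, ← h1]
  congr 1
  refine tsum_congr fun i => ?_
  rw [show n + (i + (m - n)) = m + i by omega]

theorem zetaTail_one_eq_zetaVal {s : ℕ} (hs : 2 ≤ s) : zetaTail s 1 = zetaVal s := by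
  have h0 : zetaTail s 0 = zetaTail s 1 := by
    have := sum_Ico_inv_pow_eq_zetaTail_sub hs zero_le_one
    simp only [Nat.Ico_zero_eq_range, Finset.range_one,
      Finset.sum_singleton, Nat.cast_zero, inv_zero] at this
    rw [zero_pow (by omega)] at this
    linarith
  rw [← h0, zetaVal, zeta_nat_eq_tsum_of_gt_one (by omega), zetaTail]
  have h1 : (∑' n : ℕ, 1 / (n : ℂ) ^ s) = ((∑' n : ℕ, ((n : ℝ)⁻¹) ^ s : ℝ) : ℂ) := by
    push_cast
    exact tsum_congr fun n => by simp
  rw [h1, Complex.ofReal_re]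
  exact tsum_congr fun n => by rw [zero_add]

theorem zetaTail_nonneg (s n : ℕ) : 0 ≤ zetaTail s n := tsum_nonneg fun i => by positivity

/-- Comparison with a telescoping series: x^(-2) ≤ 2 (1/x - 1/(x + 1)) for x ≥ 1, the other q
factors being bounded by their value at the start of the tail. -/
theorem zetaTail_le (q : ℕ) {n : ℕ} (hn : 0 < n) :
    zetaTail (q + 2) n ≤ 2 * ((n : ℝ)⁻¹) ^ (q + 1) := by
  have hn' : (0 : ℝ) < n := by exact_mod_cast hn
  refine Real.tsum_le_of_sum_range_le (fun i => by positivity) fun N => ?_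
  have h1 : ∀ i : ℕ, (((n + i : ℕ) : ℝ)⁻¹) ^ (q + 2) ≤
      2 * ((n : ℝ)⁻¹) ^ q * (((n + i : ℕ) : ℝ)⁻¹ - ((n + (i + 1) : ℕ) : ℝ)⁻¹) := by
    intro i
    have hx : (1 : ℝ) ≤ ((n + i : ℕ) : ℝ) := by exact_mod_cast (by omega : 1 ≤ n + i)
    have hxn : (n : ℝ) ≤ ((n + i : ℕ) : ℝ) := by exact_mod_cast Nat.le_add_right n i
    have e : ((n + (i + 1) : ℕ) : ℝ) = ((n + i : ℕ) : ℝ) + 1 := by push_cast; ring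
    rw [e]
    set x : ℝ := ((n + i : ℕ) : ℝ)
    have h2 : (x⁻¹) ^ q ≤ ((n : ℝ)⁻¹) ^ q :=
      pow_le_pow_left₀ (by positivity) (inv_anti₀ hn' hxn) q
    have h3 : (x⁻¹) ^ 2 ≤ 2 * (x⁻¹ - (x + 1)⁻¹) := by
      have : 2 * (x⁻¹ - (x + 1)⁻¹) - (x⁻¹) ^ 2 = (x - 1) / (x ^ 2 * (x + 1)) := by
        field_simp
        ring
      have h4 : 0 ≤ (x - 1) / (x ^ 2 * (x + 1)) := by
        apply div_nonneg <;> [linarith; positivity]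
      linarith
    calc (x⁻¹) ^ (q + 2) = (x⁻¹) ^ q * (x⁻¹) ^ 2 := pow_add _ _ _
      _ ≤ ((n : ℝ)⁻¹) ^ q * (2 * (x⁻¹ - (x + 1)⁻¹)) := by gcongr
      _ = _ := by ring
  refine (Finset.sum_le_sum fun i _ => h1 i).trans ?_
  rw [← Finset.mul_sum, Finset.sum_range_sub' (fun i : ℕ => ((n + i : ℕ) : ℝ)⁻¹), add_zero,
    pow_succ, ← mul_assoc]
  gcongr
  have : 0 ≤ ((n + N : ℕ) : ℝ)⁻¹ := by positivity
  linarith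

theorem isBigO_zetaTail (q : ℕ) :
    (zetaTail (q + 2)) =O[atTop] (fun n : ℕ => ((n : ℝ)⁻¹) ^ (q + 1)) := by
  refine IsBigO.of_bound 2 ?_
  filter_upwards [eventually_gt_atTop 0] with n hn
  rw [Real.norm_of_nonneg (zetaTail_nonneg _ _), Real.norm_of_nonneg (by positivity)]
  exact zetaTail_le q hn

theorem isBigO_tsum_shift {h : ℕ → ℝ} {q : ℕ}
    (hh : h =O[atTop] (fun n : ℕ => ((n : ℝ)⁻¹) ^ (q + 2))) :
    (fun n => ∑' i, h (n + i)) =O[atTop] (fun n : ℕ => ((n : ℝ)⁻¹) ^ (q + 1)) := by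
  obtain ⟨C, hC⟩ := hh.bound
  obtain ⟨n₀, hn₀⟩ := eventually_atTop.1 hC
  refine IsBigO.trans (IsBigO.of_bound C ?_) (isBigO_zetaTail q)
  filter_upwards [eventually_ge_atTop n₀] with n hn
  rw [Real.norm_of_nonneg (zetaTail_nonneg _ _), zetaTail]
  refine tsum_of_norm_bounded
    ((summable_inv_pow_shift (by omega : 2 ≤ q + 2) n).hasSum.mul_left C) fun i => ?_
  have := hn₀ (n + i) (by omega)
  rwa [Real.norm_of_nonneg (r := (((n + i : ℕ) : ℝ)⁻¹) ^ (q + 2)) (by positivity)] at this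

theorem hasSum_inv_pow_sub {r : ℕ} (hr : r ≠ 0) (n : ℕ) :
    HasSum (fun i : ℕ => (((n + i : ℕ) : ℝ)⁻¹) ^ r - (((n + i + 1 : ℕ) : ℝ)⁻¹) ^ r)
      (((n : ℝ)⁻¹) ^ r) := by
  -- With the convention 0⁻¹ = 0, the term at n + i = 0 equals -1. Nonnegativity holds from the
  -- second term on, so summability is checked below after a shift by one.
  have h0 : ∀ i : ℕ, 0 ≤ (((n + i : ℕ) : ℝ)⁻¹) ^ r - (((n + i + 1 : ℕ) : ℝ)⁻¹) ^ r ∨ n + i = 0 := by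
    intro i
    rcases Nat.eq_zero_or_pos (n + i) with h | h
    · exact Or.inr h
    · left
      rw [sub_nonneg]
      refine pow_le_pow_left₀ (by positivity) (inv_anti₀ (by exact_mod_cast h) ?_) r
      exact_mod_cast Nat.le_succ _
  have ht : Tendsto (fun N : ℕ => ∑ i ∈ Finset.range N,
      ((((n + i : ℕ) : ℝ)⁻¹) ^ r - (((n + i + 1 : ℕ) : ℝ)⁻¹) ^ r)) atTop (𝓝 (((n : ℝ)⁻¹) ^ r)) := by
    have h1 : ∀ N : ℕ, ∑ i ∈ Finset.range N,
        ((((n + i : ℕ) : ℝ)⁻¹) ^ r - (((n + i + 1 : ℕ) : ℝ)⁻¹) ^ r) =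
        ((n : ℝ)⁻¹) ^ r - (((N + n : ℕ) : ℝ)⁻¹) ^ r := by
      intro N
      have := Finset.sum_range_sub' (fun i : ℕ => (((n + i : ℕ) : ℝ)⁻¹) ^ r) N
      simp only [add_zero, ← add_assoc] at this
      rw [this, add_comm N n]
    simp only [h1]
    have h2 : Tendsto (fun N : ℕ => (((N + n : ℕ) : ℝ)⁻¹) ^ r) atTop (𝓝 (0 ^ r)) :=
      ((tendsto_add_atTop_iff_nat n).2
        (tendsto_inv_atTop_nhds_zero_nat (𝕜 := ℝ))).pow r
    rw [zero_pow hr] at h2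
    simpa using h2.const_sub (((n : ℝ)⁻¹) ^ r)
  refine (Summable.hasSum_iff_tendsto_nat ?_).2 ht
  refine (summable_nat_add_iff 1).1 ?_
  refine summable_of_sum_range_le (c := (((n + 1 : ℕ) : ℝ)⁻¹) ^ r) (fun i => ?_) fun N => ?_
  · exact (h0 (i + 1)).resolve_right (by omega)
  · have := Finset.sum_range_sub' (fun i : ℕ => (((n + (i + 1) : ℕ) : ℝ)⁻¹) ^ r) N
    simp only [zero_add, ← add_assoc] at this ⊢
    rw [this]
    have : 0 ≤ (((n + N + 1 : ℕ) : ℝ)⁻¹) ^ r := by positivity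
    linarith

/-- The tail of the zeta series at `r + 1`, normalized to have a finite nonzero limit. -/
noncomputable def scaledZetaTail (r n : ℕ) : ℝ := (n : ℝ) ^ r * zetaTail (r + 1) n

theorem zetaTail_eq_inv_pow_mul (r : ℕ) {n : ℕ} (hn : 0 < n) :
    zetaTail (r + 1) n = ((n : ℝ)⁻¹) ^ r * scaledZetaTail r n := by
  rw [scaledZetaTail, ← mul_assoc, ← mul_pow, inv_mul_cancel₀ (by positivity), one_pow, one_mul]

/-- Expand n^(-r) - (n + 1)^(-r) as r n^(-r-1) minus higher powers of 1/n, by the binomial series.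
Summed from n on, the left side telescopes to n^(-r) and each power becomes a zeta tail. Solving for
the tail of exponent r + 1 expresses it through tails of larger exponent, a form of Euler–Maclaurin
summation. -/
theorem isBigO_scaledZetaTail_sub {r : ℕ} (hr : r ≠ 0) (M : ℕ) :
    (fun n : ℕ => scaledZetaTail r n - (r : ℝ)⁻¹ * (1 + ∑ l ∈ Finset.range M,
      PowerSeries.coeff (l + 2) (negBinomSeries r) *
        (((n : ℝ)⁻¹) ^ (l + 1) * scaledZetaTail (r + l + 1) n))) =O[atTop]
      (fun n : ℕ => ((n : ℝ)⁻¹) ^ (M + 1)) := by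
  have hr' : (r : ℝ) ≠ 0 := by exact_mod_cast hr
  set γ : ℕ → ℝ := fun i => PowerSeries.coeff i (negBinomSeries r) with hγ
  -- The Taylor remainder of n^(-r) - (n + 1)^(-r); its sum over a tail is the error to be
  -- estimated.
  set h : ℕ → ℝ := fun n => ((n : ℝ)⁻¹) ^ r - (((n + 1 : ℕ) : ℝ)⁻¹) ^ r
    - r * ((n : ℝ)⁻¹) ^ (r + 1)
    + ∑ l ∈ Finset.range M, γ (l + 2) * ((n : ℝ)⁻¹) ^ (r + l + 2) with hh
  have hO : h =O[atTop] (fun n : ℕ => ((n : ℝ)⁻¹) ^ ((r + M) + 2)) := by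
    have h1 := hasInvPowExpansion_one_add_inv_pow_inv r (M + 2)
    have h2 := (isBigO_refl (fun n : ℕ => ((n : ℝ)⁻¹) ^ r) atTop).mul h1.neg_left
    refine h2.congr' ?_ (Eventually.of_forall fun n => by simp only [← pow_add]; congr 1)
    filter_upwards [eventually_gt_atTop 0] with n hn
    have hn' : (n : ℝ) ≠ 0 := by positivity
    have e1 : (((n + 1 : ℕ) : ℝ)⁻¹) ^ r = ((n : ℝ)⁻¹) ^ r * ((1 + (n : ℝ)⁻¹) ^ r)⁻¹ := by
      rw [← inv_pow, ← mul_pow]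
      congr 1
      push_cast
      field_simp
    rw [PowerSeries.eval_trunc_eq_sum, Finset.sum_range_succ', Finset.sum_range_succ',
      coeff_zero_negBinomSeries, zero_add, coeff_one_negBinomSeries, hh]
    simp only [e1]
    have e2 : ∑ l ∈ Finset.range M, γ (l + 2) * ((n : ℝ)⁻¹) ^ (r + l + 2) =
        ((n : ℝ)⁻¹) ^ r * ∑ l ∈ Finset.range M, γ (l + 2) * ((n : ℝ)⁻¹) ^ (l + 2) := by
      rw [Finset.mul_sum]
      exact Finset.sum_congr rfl fun l _ => by ring
    rw [e2]
    simp only [hγ, add_assoc, one_add_one_eq_two]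
    ring
  have hS : ∀ n, ∑' i, h (n + i) = ((n : ℝ)⁻¹) ^ r - r * zetaTail (r + 1) n
      + ∑ l ∈ Finset.range M, γ (l + 2) * zetaTail (r + l + 2) n := by
    intro n
    refine HasSum.tsum_eq ?_
    have hs : ∀ s, 2 ≤ s → HasSum (fun i : ℕ => (((n + i : ℕ) : ℝ)⁻¹) ^ s) (zetaTail s n) :=
      fun s hs => (summable_inv_pow_shift hs n).hasSum
    exact ((hasSum_inv_pow_sub hr n).sub ((hs (r + 1) (by omega)).mul_left _)).add
      (hasSum_sum fun l _ => (hs (r + l + 2) (by omega)).mul_left _)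
  have h3 := isBigO_tsum_shift hO
  have h4 := ((isBigO_refl (fun n : ℕ => (n : ℝ) ^ r) atTop).mul h3).const_mul_left (-(r : ℝ)⁻¹)
  refine h4.congr' ?_ ?_
  · filter_upwards [eventually_gt_atTop 0] with n hn
    have hn' : (n : ℝ) ≠ 0 := by positivity
    have e0 : (n : ℝ) ^ r * ((n : ℝ)⁻¹) ^ r = 1 := by rw [← mul_pow, mul_inv_cancel₀ hn', one_pow]
    have e2 : ∀ l, (n : ℝ) ^ r * zetaTail (r + l + 2) n =
        ((n : ℝ)⁻¹) ^ (l + 1) * scaledZetaTail (r + l + 1) n := by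
      intro l
      rw [zetaTail_eq_inv_pow_mul (r + l + 1) hn, add_assoc r l 1, pow_add]
      linear_combination ((n : ℝ)⁻¹) ^ (l + 1) * scaledZetaTail (r + (l + 1)) n * e0
    rw [hS]
    have e3 : ∑ l ∈ Finset.range M, γ (l + 2) *
        (((n : ℝ)⁻¹) ^ (l + 1) * scaledZetaTail (r + l + 1) n) =
        (n : ℝ) ^ r * ∑ l ∈ Finset.range M, γ (l + 2) * zetaTail (r + l + 2) n := by
      rw [Finset.mul_sum]
      exact Finset.sum_congr rfl fun l _ => by rw [← e2]; ring
    rw [e3, scaledZetaTail]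
    have e4 : (r : ℝ)⁻¹ * r = 1 := inv_mul_cancel₀ hr'
    linear_combination (n : ℝ) ^ r * zetaTail (r + 1) n * e4 - (r : ℝ)⁻¹ * e0
  · filter_upwards [eventually_gt_atTop 0] with n hn
    have hn' : (n : ℝ) ≠ 0 := by positivity
    have e0 : (n : ℝ) ^ r * ((n : ℝ)⁻¹) ^ r = 1 := by rw [← mul_pow, mul_inv_cancel₀ hn', one_pow]
    rw [add_assoc r M 1, pow_add, ← mul_assoc, e0, one_mul]

/-- Induction on the order, for all exponents at once: the tail of index r + l + 1 enters with a
factor n^(-l-1), so knowing it to order M gives order M + 1 for index r. -/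
theorem exists_invPowApprox_scaledZetaTail (N : ℕ) :
    ∀ r : ℕ, r ≠ 0 → ∃ p, InvPowApprox N (scaledZetaTail r) p := by
  induction N with
  | zero =>
    intro r hr
    refine ⟨0, InvPowApprox.zero_iff.2 ?_⟩
    obtain ⟨q, rfl⟩ := Nat.exists_eq_succ_of_ne_zero hr
    refine ((isBigO_refl (fun n : ℕ => (n : ℝ) ^ (q + 1)) atTop).mul (isBigO_zetaTail q)).congr'
      (Eventually.of_forall fun n => rfl) ?_
    filter_upwards [eventually_gt_atTop 0] with n hn
    rw [← mul_pow, mul_inv_cancel₀ (by positivity), one_pow, pow_zero]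
  | succ M ih =>
    intro r hr
    have h1 : ∀ l, ∃ p, InvPowApprox (M + 1)
        (fun n => ((n : ℝ)⁻¹) ^ (l + 1) * scaledZetaTail (r + l + 1) n) p := by
      intro l
      obtain ⟨p, hp⟩ := ih (r + l + 1) (by omega)
      exact ⟨_, (hp.X_pow_mul (l + 1)).mono (by omega)⟩
    choose p hp using h1
    have h2 := InvPowApprox.sum (s := Finset.range M) fun l _ =>
      (HasInvPowExpansion.const (PowerSeries.coeff (l + 2) (negBinomSeries r)) (M + 1)).mul (hp l)
    have h3 := (HasInvPowExpansion.const ((r : ℝ)⁻¹) (M + 1)).mul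
      ((HasInvPowExpansion.const 1 (M + 1)).add h2)
    have h4 := (InvPowApprox.zero_iff.2 (isBigO_scaledZetaTail_sub hr M)).add h3
    exact ⟨_, h4.congr_fun' (Eventually.of_forall fun n => by ring)⟩

theorem exists_hasInvPowExpansion_scaledZetaTail (r : ℕ) :
    -- The condition on `r` sits inside the existential so that a series can be chosen for every
    -- `r`.
    ∃ p, r ≠ 0 → HasInvPowExpansion (scaledZetaTail r) p := by
  rcases eq_or_ne r 0 with hr | hr
  · exact ⟨0, fun h => absurd hr h⟩
  · obtain ⟨p, hp⟩ := HasInvPowExpansion.exists_of_forall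
      fun N => exists_invPowApprox_scaledZetaTail N r hr
    exact ⟨p, fun _ => hp⟩

/-- The asymptotic expansion of `scaledZetaTail r`. -/
noncomputable def zetaTailSeries (r : ℕ) : PowerSeries ℝ :=
  (exists_hasInvPowExpansion_scaledZetaTail r).choose

theorem hasInvPowExpansion_scaledZetaTail {r : ℕ} (hr : r ≠ 0) :
    HasInvPowExpansion (scaledZetaTail r) (zetaTailSeries r) :=
  (exists_hasInvPowExpansion_scaledZetaTail r).choose_spec hr

/-- By uniqueness of expansions, the relation between tails becomes a recurrence for their
coefficients. The values found below are the first Euler–Maclaurin terms. -/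
theorem coeff_zetaTailSeries {r : ℕ} (hr : r ≠ 0) (n : ℕ) :
    PowerSeries.coeff n (zetaTailSeries r) = (r : ℝ)⁻¹ *
      (PowerSeries.coeff n 1 + ∑ l ∈ Finset.range n, PowerSeries.coeff (l + 2) (negBinomSeries r) *
        PowerSeries.coeff (n - (l + 1)) (zetaTailSeries (r + l + 1))) := by
  have h2 := HasInvPowExpansion.sum (s := Finset.range n) fun l _ =>
    ((hasInvPowExpansion_scaledZetaTail (r := r + l + 1) (by omega)).inv_pow_mul (l + 1)).const_mul
      (PowerSeries.coeff (l + 2) (negBinomSeries r))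
  have h3 := ((HasInvPowExpansion.const 1).add h2).const_mul ((r : ℝ)⁻¹)
  have h4 := (InvPowApprox.zero_iff.2 (isBigO_scaledZetaTail_sub hr n)).add (h3 (n + 1))
  have h5 := (h4.congr_fun' (g := scaledZetaTail r)
    (Eventually.of_forall fun n => by ring)).coeff_eq
    (hasInvPowExpansion_scaledZetaTail hr (n + 1)) n n.lt_succ_self
  rw [← h5, zero_add, PowerSeries.coeff_C_mul, map_add, map_sum, map_one]
  congr 2
  refine Finset.sum_congr rfl fun l hl => ?_
  rw [Finset.mem_range] at hl
  rw [PowerSeries.coeff_C_mul, PowerSeries.coeff_X_pow_mul', if_pos (by omega)]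

theorem coeff_zero_zetaTailSeries {r : ℕ} (hr : r ≠ 0) :
    PowerSeries.coeff 0 (zetaTailSeries r) = (r : ℝ)⁻¹ := by
  simp [coeff_zetaTailSeries hr]

theorem coeff_one_zetaTailSeries {r : ℕ} (hr : r ≠ 0) :
    PowerSeries.coeff 1 (zetaTailSeries r) = 1 / 2 := by
  have h1 : (r : ℝ) ≠ 0 := by exact_mod_cast hr
  have h2 : (r : ℝ) + 1 ≠ 0 := by positivity
  rw [coeff_zetaTailSeries hr, Finset.sum_range_one, coeff_two_negBinomSeries,
    coeff_zero_zetaTailSeries (by omega), PowerSeries.coeff_one, if_neg one_ne_zero]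
  push_cast
  field_simp
  ring

theorem coeff_two_zetaTailSeries {r : ℕ} (hr : r ≠ 0) :
    PowerSeries.coeff 2 (zetaTailSeries r) = (r + 1) / 12 := by
  have h1 : (r : ℝ) ≠ 0 := by exact_mod_cast hr
  have h2 : (r : ℝ) + 2 ≠ 0 := by positivity
  rw [coeff_zetaTailSeries hr, Finset.sum_range_succ, Finset.sum_range_one,
    coeff_two_negBinomSeries, coeff_three_negBinomSeries, coeff_zero_zetaTailSeries (by omega),
    coeff_one_zetaTailSeries (by omega), PowerSeries.coeff_one, if_neg two_ne_zero]
  push_cast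
  rw [show (r : ℝ) + 1 + 1 = r + 2 by ring]
  field_simp
  ring

/-! ### Counting digits in concatenated strings -/

/-- The number of occurrences of the digit `d` in the base `b` representation of `n`. -/
def digitCount (b d n : ℕ) : ℕ := (Nat.digits b n).count d

theorem digitCount_zero (b d : ℕ) : digitCount b d 0 = 0 := by simp [digitCount]

theorem digitCount_mul_add {b d : ℕ} (hb : 1 < b) (hd : 0 < d) (n : ℕ) {a : ℕ} (ha : a < b) :
    digitCount b d (b * n + a) = digitCount b d n + if a = d then 1 else 0 := by
  -- The digit list of 0 is empty, so this case escapes the digit recursion; the count is still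
  -- right because d ≠ 0.
  by_cases h : a = 0 ∧ n = 0
  · obtain ⟨rfl, rfl⟩ := h
    simp [digitCount_zero, hd.ne]
  · rw [digitCount, add_comm, Nat.digits_add b hb a n ha (by tauto), List.count_cons, digitCount]
    simp

theorem digitCount_of_lt {b d : ℕ} (hb : 1 < b) (hd : 0 < d) {a : ℕ} (ha : a < b) :
    digitCount b d a = if a = d then 1 else 0 := by
  simpa [digitCount_zero] using digitCount_mul_add hb hd 0 ha

/-- Since d ≠ 0, padding the lower block with leading zeros does not change its count, so counts add
even when `n` has fewer than `l` digits. -/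
theorem digitCount_mul_pow_add {b d : ℕ} (hb : 1 < b) (hd : 0 < d) (N l : ℕ) :
    ∀ {n : ℕ}, n < b ^ l → digitCount b d (N * b ^ l + n) = digitCount b d N + digitCount b d n := by
  induction l with
  | zero =>
    intro n hn
    obtain rfl : n = 0 := by simpa using hn
    simp [digitCount_zero]
  | succ l ih =>
    intro n hn
    have h1 : n / b < b ^ l := Nat.div_lt_of_lt_mul (by rwa [← pow_succ'])
    have h2 : n % b < b := Nat.mod_lt _ (by omega)
    have h3 : N * b ^ (l + 1) + n = b * (N * b ^ l + n / b) + n % b := by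
      conv_lhs => rw [← Nat.div_add_mod n b]
      ring
    rw [h3, digitCount_mul_add hb hd _ h2, ih h1, add_assoc, ← digitCount_mul_add hb hd _ h2,
      Nat.div_add_mod]

theorem Finset.sum_range_mul_eq {M : Type*} [AddCommMonoid M] (f : ℕ → M) (B q : ℕ) :
    ∑ i ∈ Finset.range (B * q), f i =
      ∑ i ∈ Finset.range B, ∑ j ∈ Finset.range q, f (i * q + j) := by
  induction B with
  | zero => simp
  | succ B ih => rw [Nat.succ_mul, Finset.sum_range_add, ih, Finset.sum_range_succ]

/-! ### Measures attached to digit strings and their moments -/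

/-- The contribution of the `l`-digit strings to `irwinMean`. -/
noncomputable def irwinBlock (b d K l : ℕ) (φ : ℝ → ℝ) : ℝ :=
  ∑ n ∈ Finset.range (b ^ l),
    if digitCount b d n + 1 = K then φ ((n : ℝ) / (b : ℝ) ^ l) / (b : ℝ) ^ l else 0

/-- Integration against the measure with mass `b ^ (-l)` at `n / b ^ l` for all `l` and all
`n < b ^ l` whose representation contains the digit `d` exactly `K - 1` times. -/
noncomputable def irwinMean (b d K : ℕ) (φ : ℝ → ℝ) : ℝ := ∑' l : ℕ, irwinBlock b d K l φ

section Block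

variable {b d : ℕ}

/-- The level is one more than the number of digits d, so level 0 is the zero measure and serves as
base case for recursions in the level. -/
theorem irwinBlock_zero (l : ℕ) (φ : ℝ → ℝ) : irwinBlock b d 0 l φ = 0 := by simp [irwinBlock]

theorem irwinBlock_succ_zero (K : ℕ) (φ : ℝ → ℝ) :
    irwinBlock b d (K + 1) 0 φ = if K = 0 then φ 0 else 0 := by
  simp [irwinBlock, digitCount_zero, eq_comm]

/-- Self-similarity: splitting off the first digit a replaces x by (a + x)/b, and the level drops by
one exactly when a = d. -/
theorem irwinBlock_succ_succ (hd : 0 < d) (hdb : d < b) (K l : ℕ) (φ : ℝ → ℝ) :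
    irwinBlock b d (K + 1) (l + 1) φ =
      (∑ a ∈ (Finset.range b).erase d, irwinBlock b d (K + 1) l (fun x => φ ((a + x) / b)) +
        irwinBlock b d K l (fun x => φ ((d + x) / b))) / b := by
  have hb : 1 < b := by omega
  have hb0 : (b : ℝ) ≠ 0 := by positivity
  have key : ∀ a ∈ Finset.range b, (∑ n ∈ Finset.range (b ^ l),
      if digitCount b d (a * b ^ l + n) + 1 = K + 1 then
        φ (((a * b ^ l + n : ℕ) : ℝ) / (b : ℝ) ^ (l + 1)) / (b : ℝ) ^ (l + 1) else 0) =
      (if a = d then irwinBlock b d K l (fun x => φ ((a + x) / b))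
        else irwinBlock b d (K + 1) l (fun x => φ ((a + x) / b))) / b := by
    intro a ha
    have h1 : ∀ n : ℕ, ((a * b ^ l + n : ℕ) : ℝ) / (b : ℝ) ^ (l + 1) =
        (a + n / (b : ℝ) ^ l) / b := by
      intro n; push_cast; rw [pow_succ]; field_simp
    have h2 : ∀ n ∈ Finset.range (b ^ l), digitCount b d (a * b ^ l + n) =
        (if a = d then 1 else 0) + digitCount b d n := fun n hn => by
      rw [digitCount_mul_pow_add hb hd a l (Finset.mem_range.1 hn),
        digitCount_of_lt hb hd (Finset.mem_range.1 ha)]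
    split_ifs with had
    · rw [irwinBlock, Finset.sum_div]
      refine Finset.sum_congr rfl fun n hn => ?_
      rw [h1, h2 n hn, if_pos had]
      by_cases hK : digitCount b d n + 1 = K
      · rw [if_pos hK, if_pos (by omega), pow_succ]; field_simp
      · rw [if_neg hK, if_neg (by omega), zero_div]
    · rw [irwinBlock, Finset.sum_div]
      refine Finset.sum_congr rfl fun n hn => ?_
      rw [h1, h2 n hn, if_neg had, zero_add]
      by_cases hK : digitCount b d n + 1 = K + 1
      · rw [if_pos hK, if_pos hK, pow_succ]; field_simp
      · rw [if_neg hK, if_neg hK, zero_div]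
  rw [irwinBlock, pow_succ', Finset.sum_range_mul_eq, Finset.sum_congr rfl key,
    ← Finset.sum_div, ← Finset.sum_erase_add _ _ (Finset.mem_range.2 hdb), if_pos rfl]
  congr 2
  exact Finset.sum_congr rfl fun a ha => if_neg (Finset.ne_of_mem_erase ha)

theorem irwinBlock_sum {ι : Type*} (s : Finset ι) (K l : ℕ) (c : ι → ℝ) (φ : ι → ℝ → ℝ) :
    irwinBlock b d K l (fun x => ∑ i ∈ s, c i * φ i x) =
      ∑ i ∈ s, c i * irwinBlock b d K l (φ i) := by
  simp only [irwinBlock, Finset.mul_sum]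
  rw [Finset.sum_comm]
  refine Finset.sum_congr rfl fun n _ => ?_
  split_ifs
  · rw [Finset.sum_div]
    exact Finset.sum_congr rfl fun i _ => by ring
  · simp

theorem irwinBlock_sub (K l : ℕ) (φ ψ : ℝ → ℝ) :
    irwinBlock b d K l (fun x => φ x - ψ x) = irwinBlock b d K l φ - irwinBlock b d K l ψ := by
  simp only [irwinBlock, ← Finset.sum_sub_distrib]
  refine Finset.sum_congr rfl fun n _ => ?_
  split_ifs
  · ring
  · simp

theorem abs_irwinBlock_le (hb : 0 < b) (K l : ℕ) {φ : ℝ → ℝ} {C : ℝ}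
    (hφ : ∀ x ∈ Set.Ico (0 : ℝ) 1, |φ x| ≤ C) :
    |irwinBlock b d K l φ| ≤ C * irwinBlock b d K l (fun _ => 1) := by
  rw [irwinBlock, irwinBlock, Finset.mul_sum]
  refine (Finset.abs_sum_le_sum_abs _ _).trans (Finset.sum_le_sum fun n hn => ?_)
  have hbl : (0 : ℝ) < (b : ℝ) ^ l := by positivity
  split_ifs
  · rw [abs_div, abs_of_pos hbl, mul_one_div]
    refine div_le_div_of_nonneg_right (hφ _ ⟨by positivity, ?_⟩) hbl.le
    rw [div_lt_one hbl]
    exact_mod_cast Finset.mem_range.1 hn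
  · simp

/-- Summing the recurrence gives S = p 0 + r S + Q, and the same inequality for partial sums gives
the bound that makes them converge. -/
theorem hasSum_of_linear_recurrence {p q : ℕ → ℝ} {r Q : ℝ} (hp : ∀ l, 0 ≤ p l) (hr : r < 1)
    (h : ∀ l, p (l + 1) = r * p l + q l) (hq0 : ∀ l, 0 ≤ q l) (hq : HasSum q Q) :
    HasSum p ((p 0 + Q) / (1 - r)) := by
  have hs : Summable p := by
    refine summable_of_sum_range_le (c := (p 0 + Q) / (1 - r)) hp fun N => ?_
    rw [le_div_iff₀ (by linarith)]
    have h1 : ∑ l ∈ Finset.range (N + 1), p l =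
        r * ∑ l ∈ Finset.range N, p l + ∑ l ∈ Finset.range N, q l + p 0 := by
      rw [Finset.sum_range_succ', Finset.mul_sum, ← Finset.sum_add_distrib]
      simp only [h]
    have h2 : ∑ l ∈ Finset.range N, q l ≤ Q := sum_le_hasSum _ (fun l _ => hq0 l) hq
    have h3 := hp N
    rw [Finset.sum_range_succ] at h1
    nlinarith
  have h1 := hs.tsum_eq_zero_add
  simp only [h] at h1
  rw [(hs.mul_left r).tsum_add hq.summable, tsum_mul_left, hq.tsum_eq] at h1
  convert hs.hasSum using 1
  rw [div_eq_iff (by linarith)]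
  linarith

theorem irwinBlock_one_nonneg (K l : ℕ) : 0 ≤ irwinBlock b d K l (fun _ => 1) := by
  rw [irwinBlock]
  exact Finset.sum_nonneg fun n _ => by split_ifs <;> positivity

/-- The masses satisfy a recurrence of ratio (b - 1)/b. At level 1 the initial value is 1 and there
is no source. At higher levels the initial value is 0 and the source, the previous mass over b, sums
to 1. Either way the total is 1/(1 - (b - 1)/b) = b. -/
theorem hasSum_irwinBlock_one (hd : 0 < d) (hdb : d < b) (K : ℕ) :
    HasSum (fun l => irwinBlock b d (K + 1) l (fun _ => 1)) b := by
  have hb0 : (0 : ℝ) < b := by exact_mod_cast (by omega : 0 < b)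
  have hrec : ∀ K l, irwinBlock b d (K + 1) (l + 1) (fun _ => 1) =
      ((b - 1) / b) * irwinBlock b d (K + 1) l (fun _ => 1) +
        irwinBlock b d K l (fun _ => 1) / b := by
    intro K l
    rw [irwinBlock_succ_succ hd hdb, Finset.sum_const,
      Finset.card_erase_of_mem (Finset.mem_range.2 hdb), Finset.card_range, nsmul_eq_mul,
      Nat.cast_sub (by omega)]
    push_cast
    ring
  have hr : ((b : ℝ) - 1) / b < 1 := by rw [div_lt_one hb0]; linarith
  have hr' : 1 - ((b : ℝ) - 1) / b = 1 / b := by field_simp; ring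
  induction K with
  | zero =>
    have := hasSum_of_linear_recurrence (irwinBlock_one_nonneg 1) hr (hrec 0)
      (fun l => div_nonneg (irwinBlock_one_nonneg _ _) hb0.le) (Q := 0) (by
        simp [irwinBlock_zero, hasSum_zero])
    rw [irwinBlock_succ_zero, if_pos rfl, hr'] at this
    simpa using this
  | succ K ih =>
    have := hasSum_of_linear_recurrence (irwinBlock_one_nonneg (K + 2)) hr (hrec (K + 1))
      (fun l => div_nonneg (irwinBlock_one_nonneg _ _) hb0.le) (ih.div_const _)
    rw [irwinBlock_succ_zero, if_neg K.succ_ne_zero, hr', div_self hb0.ne'] at this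
    simpa using this

theorem summable_irwinBlock (hd : 0 < d) (hdb : d < b) (K : ℕ) {φ : ℝ → ℝ} {C : ℝ}
    (hφ : ∀ x ∈ Set.Ico (0 : ℝ) 1, |φ x| ≤ C) : Summable fun l => irwinBlock b d K l φ := by
  cases K with
  | zero => simp [irwinBlock_zero, summable_zero]
  | succ K =>
    exact Summable.of_norm_bounded ((hasSum_irwinBlock_one hd hdb K).summable.mul_left C)
      fun l => abs_irwinBlock_le (by omega) _ l hφ

theorem abs_irwinMean_le (hd : 0 < d) (hdb : d < b) (K : ℕ) {φ : ℝ → ℝ} {C : ℝ}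
    (hφ : ∀ x ∈ Set.Ico (0 : ℝ) 1, |φ x| ≤ C) : |irwinMean b d (K + 1) φ| ≤ C * b := by
  rw [← Real.norm_eq_abs, irwinMean]
  exact tsum_of_norm_bounded ((hasSum_irwinBlock_one hd hdb K).mul_left C)
    fun l => abs_irwinBlock_le (by omega) _ l hφ

/-- The moments of the measure of `irwinMean`. -/
noncomputable def irwinMoment (b d K m : ℕ) : ℝ := irwinMean b d K (fun x => x ^ m)

theorem abs_pow_le_one_of_mem_Ico (m : ℕ) : ∀ x ∈ Set.Ico (0 : ℝ) 1, |x ^ m| ≤ 1 := fun x hx => by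
  rw [abs_of_nonneg (pow_nonneg hx.1 m)]
  exact pow_le_one₀ hx.1 hx.2.le

theorem hasSum_irwinMoment (hd : 0 < d) (hdb : d < b) (K m : ℕ) :
    HasSum (fun l => irwinBlock b d K l (fun x => x ^ m)) (irwinMoment b d K m) :=
  (summable_irwinBlock hd hdb K (abs_pow_le_one_of_mem_Ico m)).hasSum

theorem irwinMoment_zero_left (m : ℕ) : irwinMoment b d 0 m = 0 := by
  simp [irwinMoment, irwinMean, irwinBlock_zero]

theorem irwinMoment_succ_zero (hd : 0 < d) (hdb : d < b) (K : ℕ) :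
    irwinMoment b d (K + 1) 0 = b := by
  have h1 := hasSum_irwinMoment hd hdb (K + 1) 0
  simp only [pow_zero] at h1
  exact h1.unique (hasSum_irwinBlock_one hd hdb K)

theorem irwinMoment_succ (hd : 0 < d) (hdb : d < b) (K : ℕ) {m : ℕ} (hm : m ≠ 0) :
    (b : ℝ) ^ (m + 1) * irwinMoment b d (K + 1) m =
      ∑ a ∈ (Finset.range b).erase d, ∑ j ∈ Finset.range (m + 1),
        (a : ℝ) ^ (m - j) * m.choose j * irwinMoment b d (K + 1) j +
      ∑ j ∈ Finset.range (m + 1), (d : ℝ) ^ (m - j) * m.choose j * irwinMoment b d K j := by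
  have hb0 : (b : ℝ) ≠ 0 := by exact_mod_cast (by omega : b ≠ 0)
  have hexp : ∀ a : ℕ, (fun x : ℝ => ((a + x) / b) ^ m) = fun x : ℝ =>
      ∑ j ∈ Finset.range (m + 1), ((a : ℝ) ^ (m - j) * m.choose j / (b : ℝ) ^ m) * x ^ j := by
    intro a
    ext x
    rw [div_pow, add_comm, add_pow, Finset.sum_div]
    exact Finset.sum_congr rfl fun j _ => by ring
  have hs : ∀ (a K : ℕ), HasSum (fun l => irwinBlock b d K l (fun x => ((a + x) / b) ^ m))
      (∑ j ∈ Finset.range (m + 1),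
        ((a : ℝ) ^ (m - j) * m.choose j / (b : ℝ) ^ m) * irwinMoment b d K j) := by
    intro a K
    simp only [hexp, irwinBlock_sum]
    exact hasSum_sum fun j _ => (hasSum_irwinMoment hd hdb K j).mul_left _
  have h1 := ((hasSum_sum (s := (Finset.range b).erase d) fun a _ => hs a (K + 1)).add
    (hs d K)).div_const (b : ℝ)
  have h2 := (hasSum_irwinMoment hd hdb (K + 1) m).summable.tsum_eq_zero_add
  rw [tsum_congr fun l => irwinBlock_succ_succ hd hdb K l _, h1.tsum_eq, irwinBlock_succ_zero, zero_pow hm, ite_self, zero_add] at h2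
  rw [irwinMoment, irwinMean, h2, pow_succ]
  have e : ∀ (a K : ℕ), ∑ j ∈ Finset.range (m + 1),
      ((a : ℝ) ^ (m - j) * m.choose j / (b : ℝ) ^ m) * irwinMoment b d K j =
      (∑ j ∈ Finset.range (m + 1), (a : ℝ) ^ (m - j) * m.choose j * irwinMoment b d K j) /
        (b : ℝ) ^ m := by
    intro a K
    rw [Finset.sum_div]
    exact Finset.sum_congr rfl fun j _ => by ring
  simp only [e]
  rw [← Finset.sum_div]
  field_simp

end Block

/-! ### Deviation of the moments from Lebesgue measure -/

/-- Both sides are the integral of (a + x)^m over [0,1]. -/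
theorem sum_choose_mul_pow_div (a : ℝ) (m : ℕ) :
    ∑ j ∈ Finset.range (m + 1), a ^ (m - j) * m.choose j / (j + 1) =
      ((a + 1) ^ (m + 1) - a ^ (m + 1)) / (m + 1) := by
  have hm : (m : ℝ) + 1 ≠ 0 := by positivity
  rw [eq_div_iff hm, add_comm a 1, add_pow,
    Finset.sum_range_succ' _ (m + 1), Finset.sum_mul]
  simp only [one_pow, one_mul, Nat.choose_zero_right, Nat.cast_one, mul_one, Nat.sub_zero,
    add_sub_cancel_right]
  refine Finset.sum_congr rfl fun j _ => ?_
  have hj : (j : ℝ) + 1 ≠ 0 := by positivity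
  have h1 : ((m : ℝ) + 1) * m.choose j = (m + 1).choose (j + 1) * (j + 1) := by
    exact_mod_cast Nat.add_one_mul_choose_eq m j
  rw [Nat.add_sub_add_right, div_mul_eq_mul_div, div_eq_iff hj]
  linear_combination a ^ (m - j) * h1

/-- The deviation of the moments of `irwinMean` from those of `b` times Lebesgue measure. -/
noncomputable def irwinDeviation (b d K m : ℕ) : ℝ := irwinMoment b d K m - b / (m + 1)

theorem irwinDeviation_zero_left (b d m : ℕ) : irwinDeviation b d 0 m = -(b / (m + 1)) := by
  rw [irwinDeviation, irwinMoment_zero_left, zero_sub]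

theorem irwinDeviation_succ_zero {b d : ℕ} (hd : 0 < d) (hdb : d < b) (K : ℕ) :
    irwinDeviation b d (K + 1) 0 = 0 := by
  rw [irwinDeviation, irwinMoment_succ_zero hd hdb]; simp

/-- The values b/(j + 1), taken at both levels, satisfy the moment recurrence: the integrals of x^m
over the intervals [a, a + 1], with a running through all digits, telescope. Subtraction leaves the
same recurrence with no extra term. -/
theorem irwinDeviation_succ {b d : ℕ} (hd : 0 < d) (hdb : d < b) (K : ℕ) {m : ℕ} (hm : m ≠ 0) :
    (b : ℝ) ^ (m + 1) * irwinDeviation b d (K + 1) m =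
      ∑ j ∈ Finset.range (m + 1), (∑ a ∈ (Finset.range b).erase d, (a : ℝ) ^ (m - j)) *
        m.choose j * irwinDeviation b d (K + 1) j +
      ∑ j ∈ Finset.range (m + 1), (d : ℝ) ^ (m - j) * m.choose j * irwinDeviation b d K j := by
  have h1 : ∀ a : ℕ, ∑ j ∈ Finset.range (m + 1), (a : ℝ) ^ (m - j) * m.choose j * (b / (j + 1)) =
      b * (((a + 1 : ℕ) : ℝ) ^ (m + 1) - (a : ℝ) ^ (m + 1)) / (m + 1) := by
    intro a
    push_cast
    rw [mul_div_assoc, ← sum_choose_mul_pow_div, Finset.mul_sum]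
    exact Finset.sum_congr rfl fun j _ => by ring
  have h2 : ∑ a ∈ Finset.range b, b * (((a + 1 : ℕ) : ℝ) ^ (m + 1) - (a : ℝ) ^ (m + 1)) / (m + 1) =
      (b : ℝ) ^ (m + 1) * (b / (m + 1)) := by
    rw [← Finset.sum_div, ← Finset.mul_sum, Finset.sum_range_sub (fun a : ℕ => (a : ℝ) ^ (m + 1))]
    simp
    ring
  rw [← Finset.sum_erase_add _ _ (Finset.mem_range.2 hdb)] at h2
  simp only [← h1] at h2
  have h3 : ∑ j ∈ Finset.range (m + 1), (∑ a ∈ (Finset.range b).erase d, (a : ℝ) ^ (m - j)) *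
        m.choose j * irwinDeviation b d (K + 1) j =
      ∑ a ∈ (Finset.range b).erase d, ∑ j ∈ Finset.range (m + 1),
        (a : ℝ) ^ (m - j) * m.choose j * irwinDeviation b d (K + 1) j := by
    rw [Finset.sum_comm]
    exact Finset.sum_congr rfl fun j _ => by rw [Finset.sum_mul, Finset.sum_mul]
  have h4 := irwinMoment_succ hd hdb K hm
  rw [h3]
  simp only [irwinDeviation, mul_sub, Finset.sum_sub_distrib] at h4 h2 ⊢
  linarith

/-! ### Decomposition of the Irwin sum by its two leading digits -/

theorem hasSum_of_tendsto_subseq {F : ℕ → ℝ} (hF : ∀ n, 0 ≤ F n) {u : ℕ → ℕ}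
    (hu : Tendsto u atTop atTop) {I : ℝ}
    (h : Tendsto (fun L => ∑ m ∈ Finset.range (u L), F m) atTop (𝓝 I)) : HasSum F I := by
  rw [hasSum_iff_tendsto_nat_of_nonneg hF]
  have hm : Monotone fun N => ∑ m ∈ Finset.range N, F m := fun M N hMN =>
    Finset.sum_le_sum_of_subset_of_nonneg (Finset.range_mono hMN) fun i _ _ => hF i
  exact (tendsto_iff_tendsto_subseq_of_monotone hm hu).2 h

theorem Finset.sum_Ico_mul_eq {M : Type*} [AddCommGroup M] (f : ℕ → M) {A B : ℕ} (h : A ≤ B)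
    (q : ℕ) : ∑ i ∈ Finset.Ico (A * q) (B * q), f i =
      ∑ i ∈ Finset.Ico A B, ∑ j ∈ Finset.range q, f (i * q + j) := by
  rw [Finset.sum_Ico_eq_sub _ h, Finset.sum_Ico_eq_sub _ (Nat.mul_le_mul_right q h),
    Finset.sum_range_mul_eq, Finset.sum_range_mul_eq]

section

variable {b d k : ℕ}

theorem digitCount_two_digits (hd : 0 < d) (hdb : d < b) {c a : ℕ} (hc : c < b) (ha : a < b) :
    digitCount b d (c * b + a) = (if c = d then 1 else 0) + if a = d then 1 else 0 := by
  have hb : 1 < b := by omega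
  have := digitCount_mul_pow_add hb hd c 1 (n := a) (by simpa using ha)
  rw [pow_one] at this
  rw [this, digitCount_of_lt hb hd hc, digitCount_of_lt hb hd ha]

theorem digitCount_le_two (hd : 0 < d) (hdb : d < b) {n : ℕ} (hn : n < b ^ 2) :
    digitCount b d n ≤ 2 := by
  have h1 : n / b < b := Nat.div_lt_of_lt_mul (by rwa [← sq])
  have h2 := digitCount_two_digits hd hdb h1 (Nat.mod_lt n (by omega))
  rw [mul_comm, Nat.div_add_mod] at h2
  rw [h2]
  split_ifs <;> omega

/-- Integers with l + 2 digits are n b^l + j with b ≤ n < b^2 and j < b^l. The digits d not used by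
`n` must occur in `j`, which fixes the level. -/
theorem sum_Ico_indicator_irwinSet (hd : 0 < d) (hdb : d < b) (l : ℕ) :
    ∑ m ∈ Finset.Ico (b ^ (l + 1)) (b ^ (l + 2)),
      (irwinSet b d k).indicator (fun m : ℕ => 1 / (m : ℝ)) m =
      ∑ n ∈ Finset.Ico b (b ^ 2),
        irwinBlock b d (k + 1 - digitCount b d n) l (fun x => 1 / (n + x)) := by
  have hb : 1 < b := by omega
  have e1 : b ^ (l + 1) = b * b ^ l := pow_succ' b l
  have e2 : b ^ (l + 2) = b ^ 2 * b ^ l := by ring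
  rw [e1, e2, Finset.sum_Ico_mul_eq _ (Nat.le_self_pow two_ne_zero b)]
  refine Finset.sum_congr rfl fun n hn => Finset.sum_congr rfl fun j hj => ?_
  rw [Finset.mem_Ico] at hn
  rw [Finset.mem_range] at hj
  have h1 := digitCount_le_two hd hdb hn.2
  have h2 := digitCount_mul_pow_add hb hd n l hj
  have hpos : 0 < n * b ^ l + j := by
    have : 0 < n * b ^ l := Nat.mul_pos (by omega) (by positivity)
    omega
  have h3 : n * b ^ l + j ∈ irwinSet b d k ↔ digitCount b d j + 1 = k + 1 - digitCount b d n := by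
    change 0 < n * b ^ l + j ∧ digitCount b d (n * b ^ l + j) = k ↔ _
    rw [h2]
    constructor
    · rintro ⟨-, h⟩; omega
    · intro h; exact ⟨hpos, by omega⟩
  have hbl : ((b : ℝ) ^ l) ≠ 0 := by positivity
  have hn0 : (0 : ℝ) < n := by exact_mod_cast (by omega : 0 < n)
  by_cases h : n * b ^ l + j ∈ irwinSet b d k
  · rw [Set.indicator_of_mem h, if_pos (h3.1 h)]
    push_cast
    have : (0 : ℝ) < n + j / (b : ℝ) ^ l := by positivity
    rw [div_div, one_div, one_div]
    congr 1
    field_simp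
  · rw [Set.indicator_of_notMem h, if_neg (fun h' => h (h3.2 h'))]

theorem abs_one_div_add_le {n : ℕ} (hn : 0 < n) :
    ∀ x ∈ Set.Ico (0 : ℝ) 1, |1 / ((n : ℝ) + x)| ≤ (n : ℝ)⁻¹ := by
  intro x hx
  have hn0 : (0 : ℝ) < n := by exact_mod_cast hn
  have := hx.1
  rw [abs_of_nonneg (by positivity), one_div]
  exact inv_anti₀ hn0 (by linarith)

theorem hasSum_indicator_irwinSet (hd : 0 < d) (hdb : d < b) (hk : 2 ≤ k) :
    HasSum ((irwinSet b d k).indicator (fun m : ℕ => 1 / (m : ℝ)))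
      (∑ n ∈ Finset.Ico b (b ^ 2),
        irwinMean b d (k + 1 - digitCount b d n) (fun x => 1 / (n + x))) := by
  have hb : 1 < b := by omega
  set F := (irwinSet b d k).indicator (fun m : ℕ => 1 / (m : ℝ)) with hF
  have hF0 : ∀ n, 0 ≤ F n := fun n => Set.indicator_nonneg (fun m _ => by positivity) n
  have hu : Tendsto (fun L : ℕ => b ^ (L + 1)) atTop atTop :=
    (tendsto_add_atTop_iff_nat 1).2 (tendsto_pow_atTop_atTop_of_one_lt hb)
  refine hasSum_of_tendsto_subseq hF0 hu ?_
  -- One-digit integers contain d at most once, so they are excluded by k ≥ 2.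
  have h0 : ∑ m ∈ Finset.range b, F m = 0 := by
    refine Finset.sum_eq_zero fun m hm => Set.indicator_of_notMem ?_ _
    rintro ⟨-, h⟩
    have h1 := digitCount_of_lt hb hd (Finset.mem_range.1 hm)
    rw [digitCount, h] at h1
    split_ifs at h1 <;> omega
  have h1 : ∀ L : ℕ, ∑ m ∈ Finset.range (b ^ (L + 1)), F m =
      ∑ l ∈ Finset.range L, ∑ n ∈ Finset.Ico b (b ^ 2),
        irwinBlock b d (k + 1 - digitCount b d n) l (fun x => 1 / (n + x)) := by
    intro L
    induction L with
    | zero => simpa using h0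
    | succ L ih =>
      rw [Finset.sum_range_succ, ← ih, ← sum_Ico_indicator_irwinSet hd hdb,
        Finset.sum_range_add_sum_Ico _ (Nat.pow_le_pow_right (by omega) (by omega))]
  simp only [h1]
  refine (hasSum_sum fun n hn => ?_).tendsto_sum_nat
  refine (summable_irwinBlock hd hdb _ (abs_one_div_add_le ?_)).hasSum
  rw [Finset.mem_Ico] at hn
  omega

theorem summable_irwinSet (hd : 0 < d) (hdb : d < b) (hk : 2 ≤ k) :
    Summable fun m : irwinSet b d k => 1 / ((m : ℕ) : ℝ) :=
  summable_subtype_iff_indicator.2 (hasSum_indicator_irwinSet hd hdb hk).summable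

theorem irwinSum_eq_sum_irwinMean (hd : 0 < d) (hdb : d < b) (hk : 2 ≤ k) :
    irwinSum b d k = ∑ n ∈ Finset.Ico b (b ^ 2),
      irwinMean b d (k + 1 - digitCount b d n) (fun x => 1 / (n + x)) := by
  rw [irwinSum, ← (hasSum_indicator_irwinSet hd hdb hk).tsum_eq]
  exact tsum_subtype (irwinSet b d k) fun m : ℕ => 1 / (m : ℝ)

theorem one_div_add_sub_sum {n x : ℝ} (hn : 0 < n) (hx : 0 ≤ x) (M : ℕ) :
    1 / (n + x) - ∑ j ∈ Finset.range M, (-1) ^ j * (n⁻¹) ^ (j + 1) * x ^ j =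
      (-1) ^ M * (n⁻¹) ^ M * x ^ M / (n + x) := by
  have h1 : n + x ≠ 0 := by positivity
  induction M with
  | zero => simp
  | succ M ih =>
    rw [Finset.sum_range_succ, ← sub_sub, ih, eq_div_iff h1, sub_mul, div_mul_cancel₀ _ h1]
    have h2 : n⁻¹ * n = 1 := inv_mul_cancel₀ hn.ne'
    rw [pow_succ, pow_succ, pow_succ]
    linear_combination -(-1) ^ M * n⁻¹ ^ M * x ^ M * h2

/-- The geometric remainder of 1/(n + x) is at most n^(-M-1) on [0,1), and the measure has mass b.
-/
theorem abs_irwinMean_sub_le (hd : 0 < d) (hdb : d < b) (K M : ℕ) {n : ℕ} (hn : 0 < n) :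
    |irwinMean b d (K + 1) (fun x => 1 / (n + x)) -
      ∑ j ∈ Finset.range M, (-1) ^ j * ((n : ℝ)⁻¹) ^ (j + 1) * irwinMoment b d (K + 1) j| ≤
      ((n : ℝ)⁻¹) ^ (M + 1) * b := by
  have hn0 : (0 : ℝ) < n := by exact_mod_cast hn
  have h1 : HasSum (fun l => irwinBlock b d (K + 1) l (fun x => 1 / (n + x) -
      ∑ j ∈ Finset.range M, ((-1) ^ j * ((n : ℝ)⁻¹) ^ (j + 1)) * x ^ j))
      (irwinMean b d (K + 1) (fun x => 1 / (n + x)) -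
      ∑ j ∈ Finset.range M, ((-1) ^ j * ((n : ℝ)⁻¹) ^ (j + 1)) * irwinMoment b d (K + 1) j) := by
    simp only [irwinBlock_sub, irwinBlock_sum]
    exact (summable_irwinBlock hd hdb _ (abs_one_div_add_le hn)).hasSum.sub
      (hasSum_sum fun j _ => (hasSum_irwinMoment hd hdb (K + 1) j).mul_left _)
  rw [← h1.tsum_eq]
  refine abs_irwinMean_le hd hdb K fun x hx => ?_
  rw [one_div_add_sub_sum hn0 hx.1, abs_div, abs_mul, abs_mul, abs_pow, abs_neg, abs_one, one_pow,
    one_mul, abs_of_pos (a := (n : ℝ)⁻¹ ^ M) (by positivity), pow_succ, div_eq_mul_inv, mul_assoc]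
  refine mul_le_mul_of_nonneg_left ?_ (by positivity)
  rw [← one_mul ((n : ℝ)⁻¹), abs_of_pos (a := (n : ℝ) + x) (by linarith [hx.1])]
  exact mul_le_mul (abs_pow_le_one_of_mem_Ico M x hx) (inv_anti₀ hn0 (by linarith [hx.1]))
    (inv_nonneg.2 (by linarith [hx.1])) zero_le_one

theorem abs_log_succ_sub_log_sub_sum_le {n : ℕ} (hn : 2 ≤ n) (M : ℕ) :
    |Real.log ((n + 1 : ℕ) : ℝ) - Real.log n -
      ∑ j ∈ Finset.range M, (-1) ^ j * ((n : ℝ)⁻¹) ^ (j + 1) / (j + 1)| ≤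
      2 * ((n : ℝ)⁻¹) ^ (M + 1) := by
  have hn0 : (2 : ℝ) ≤ n := by exact_mod_cast hn
  have hx : |-(n : ℝ)⁻¹| = (n : ℝ)⁻¹ := by rw [abs_neg, abs_of_pos (by positivity)]
  have hle : (n : ℝ)⁻¹ ≤ 1 / 2 := by
    rw [one_div]; exact inv_anti₀ two_pos hn0
  have h1 := Real.abs_log_sub_add_sum_range_le (x := -(n : ℝ)⁻¹) (by rw [hx]; linarith) M
  rw [hx, sub_neg_eq_add] at h1
  have h2 : Real.log (1 + (n : ℝ)⁻¹) = Real.log ((n + 1 : ℕ) : ℝ) - Real.log n := by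
    rw [← Real.log_div (by positivity) (by positivity)]
    congr 1
    push_cast
    field_simp
  have h3 : ∑ i ∈ Finset.range M, (-(n : ℝ)⁻¹) ^ (i + 1) / ((i : ℝ) + 1) =
      -∑ j ∈ Finset.range M, (-1) ^ j * ((n : ℝ)⁻¹) ^ (j + 1) / (j + 1) := by
    rw [← Finset.sum_neg_distrib]
    refine Finset.sum_congr rfl fun j _ => ?_
    rw [neg_pow, pow_succ (-1 : ℝ)]
    ring
  rw [h2, h3, neg_add_eq_sub] at h1
  refine h1.trans ?_
  rw [div_le_iff₀ (by linarith)]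
  have : 0 ≤ ((n : ℝ)⁻¹) ^ (M + 1) := by positivity
  nlinarith

/-- The Irwin sum in terms of the moments, through the two leading digits. -/
theorem abs_irwinSum_sub_le (hd : 0 < d) (hdb : d < b) (hk : 2 ≤ k) (M : ℕ) :
    |irwinSum b d k - b * Real.log b - ∑ j ∈ Finset.range M, (-1) ^ j *
      ∑ n ∈ Finset.Ico b (b ^ 2),
        ((n : ℝ)⁻¹) ^ (j + 1) * irwinDeviation b d (k + 1 - digitCount b d n) j| ≤
      3 * ((b : ℝ) ^ 3 * ((b : ℝ)⁻¹) ^ (M + 1)) := by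
  have hb : 1 < b := by omega
  have hb0 : (0 : ℝ) < b := by exact_mod_cast (by omega : 0 < b)
  -- The Lebesgue part telescopes to b (log b^2 - log b).
  have hlog : ∑ n ∈ Finset.Ico b (b ^ 2), (b : ℝ) *
      (Real.log ((n + 1 : ℕ) : ℝ) - Real.log n) = b * Real.log b := by
    rw [← Finset.mul_sum, Finset.sum_Ico_sub (fun n : ℕ => Real.log n)
      (Nat.le_self_pow two_ne_zero b)]
    push_cast
    rw [Real.log_pow]
    push_cast
    ring
  -- The constant 3 is 1 from the geometric remainder plus 2 from the logarithm.
  have hterm : ∀ n ∈ Finset.Ico b (b ^ 2),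
      |irwinMean b d (k + 1 - digitCount b d n) (fun x => 1 / (n + x)) -
        b * (Real.log ((n + 1 : ℕ) : ℝ) - Real.log n) - ∑ j ∈ Finset.range M,
        (-1) ^ j * (((n : ℝ)⁻¹) ^ (j + 1) * irwinDeviation b d (k + 1 - digitCount b d n) j)| ≤
      3 * b * ((b : ℝ)⁻¹) ^ (M + 1) := by
    intro n hn
    rw [Finset.mem_Ico] at hn
    obtain ⟨K, hK⟩ : ∃ K, k + 1 - digitCount b d n = K + 1 :=
      ⟨k - digitCount b d n, by have := digitCount_le_two hd hdb hn.2; omega⟩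
    rw [hK]
    have h1 := abs_irwinMean_sub_le hd hdb K M (n := n) (by omega)
    have h2 := mul_le_mul_of_nonneg_left
      (abs_log_succ_sub_log_sub_sum_le (n := n) (by omega) M) hb0.le
    rw [← abs_of_pos hb0, ← abs_mul, abs_of_pos hb0] at h2
    have h3 : ((n : ℝ)⁻¹) ^ (M + 1) ≤ ((b : ℝ)⁻¹) ^ (M + 1) :=
      pow_le_pow_left₀ (by positivity) (inv_anti₀ hb0 (by exact_mod_cast hn.1)) _
    have h4 := (abs_sub _ _).trans (add_le_add h1 h2)
    refine (le_of_eq (congrArg _ ?_)).trans (h4.trans ?_)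
    · simp only [irwinDeviation, mul_sub, Finset.sum_sub_distrib, Finset.mul_sum]
      have e1 : ∀ j : ℕ, (-1 : ℝ) ^ j * (((n : ℝ)⁻¹) ^ (j + 1) * (b / (j + 1))) =
        b * ((-1) ^ j * ((n : ℝ)⁻¹) ^ (j + 1) / (j + 1)) := fun j => by ring
      have e2 : ∀ j : ℕ, (-1 : ℝ) ^ j * (((n : ℝ)⁻¹) ^ (j + 1) * irwinMoment b d (K + 1) j) =
        (-1) ^ j * ((n : ℝ)⁻¹) ^ (j + 1) * irwinMoment b d (K + 1) j := fun j => by ring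
      simp only [e1, e2]
      ring
    · nlinarith
  rw [irwinSum_eq_sum_irwinMean hd hdb hk, ← hlog]
  simp only [Finset.mul_sum] at hterm ⊢
  rw [Finset.sum_comm (s := Finset.range M), ← Finset.sum_sub_distrib, ← Finset.sum_sub_distrib]
  refine (Finset.abs_sum_le_sum_abs _ _).trans ((Finset.sum_le_sum hterm).trans ?_)
  rw [Finset.sum_const, Nat.card_Ico, nsmul_eq_mul]
  have h5 : ((b ^ 2 - b : ℕ) : ℝ) ≤ (b : ℝ) ^ 2 := by exact_mod_cast Nat.sub_le _ _
  calc ((b ^ 2 - b : ℕ) : ℝ) * (3 * b * ((b : ℝ)⁻¹) ^ (M + 1))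
      ≤ (b : ℝ) ^ 2 * (3 * b * ((b : ℝ)⁻¹) ^ (M + 1)) := by gcongr
    _ = _ := by ring

/-- Inclusion–exclusion on which leading digits equal d: every `n` is first given level k + 1, then
the row and the column are corrected to level k, and their intersection d b + d to level k - 1. -/
theorem sum_Ico_irwinDeviation (hd : 0 < d) (hdb : d < b) {k : ℕ} (hk : 2 ≤ k) (g : ℕ → ℝ) (j : ℕ) :
    ∑ n ∈ Finset.Ico b (b ^ 2), g n * irwinDeviation b d (k + 1 - digitCount b d n) j =
      irwinDeviation b d (k + 1) j * ∑ n ∈ Finset.Ico b (b ^ 2), g n +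
      (irwinDeviation b d k j - irwinDeviation b d (k + 1) j) *
        (∑ a ∈ Finset.range b, g (d * b + a) + ∑ c ∈ Finset.Ico 1 b, g (c * b + d)) +
      (irwinDeviation b d (k + 1) j - 2 * irwinDeviation b d k j +
        irwinDeviation b d (k - 1) j) * g (d * b + d) := by
  set e := fun K => irwinDeviation b d K j with he
  have hsplit : ∀ f : ℕ → ℝ, ∑ n ∈ Finset.Ico b (b ^ 2), f n =
      ∑ c ∈ Finset.Ico 1 b, ∑ a ∈ Finset.range b, f (c * b + a) := by
    intro f
    have := Finset.sum_Ico_mul_eq f (show 1 ≤ b by omega) b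
    rwa [one_mul, ← sq] at this
  have hd1 : d ∈ Finset.Ico 1 b := Finset.mem_Ico.2 ⟨hd, hdb⟩
  have hd2 : d ∈ Finset.range b := Finset.mem_range.2 hdb
  have hterm : ∀ c ∈ Finset.Ico 1 b, ∀ a ∈ Finset.range b,
      g (c * b + a) * e (k + 1 - digitCount b d (c * b + a)) =
      e (k + 1) * g (c * b + a) + (if c = d then (e k - e (k + 1)) * g (c * b + a) else 0) +
      (if a = d then (e k - e (k + 1)) * g (c * b + a) else 0) +
      (if c = d then if a = d then (e (k + 1) - 2 * e k + e (k - 1)) * g (c * b + a) else 0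
        else 0) := by
    intro c hc a ha
    rw [digitCount_two_digits hd hdb (Finset.mem_Ico.1 hc).2 (Finset.mem_range.1 ha)]
    split_ifs
    · rw [show k + 1 - (1 + 1) = k - 1 by omega]; ring
    · rw [show k + 1 - (1 + 0) = k by omega]; ring
    · rw [show k + 1 - (0 + 1) = k by omega]; ring
    · rw [show k + 1 - (0 + 0) = k + 1 by omega]; ring
  rw [hsplit, hsplit, Finset.sum_congr rfl fun c hc => Finset.sum_congr rfl (hterm c hc)]
  simp only [Finset.sum_add_distrib]
  have h1 : ∑ c ∈ Finset.Ico 1 b, ∑ a ∈ Finset.range b,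
      (if c = d then (e k - e (k + 1)) * g (c * b + a) else 0) =
      (e k - e (k + 1)) * ∑ a ∈ Finset.range b, g (d * b + a) := by
    rw [Finset.sum_eq_single_of_mem d hd1 fun c _ hc => by simp [hc], Finset.mul_sum]
    simp
  have h2 : ∑ c ∈ Finset.Ico 1 b, ∑ a ∈ Finset.range b,
      (if a = d then (e k - e (k + 1)) * g (c * b + a) else 0) =
      (e k - e (k + 1)) * ∑ c ∈ Finset.Ico 1 b, g (c * b + d) := by
    rw [Finset.mul_sum]
    exact Finset.sum_congr rfl fun c _ => by rw [Finset.sum_ite_eq', if_pos hd2]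
  have h3 : ∑ c ∈ Finset.Ico 1 b, ∑ a ∈ Finset.range b,
      (if c = d then if a = d then (e (k + 1) - 2 * e k + e (k - 1)) * g (c * b + a) else 0
        else 0) = (e (k + 1) - 2 * e k + e (k - 1)) * g (d * b + d) := by
    rw [Finset.sum_eq_single_of_mem d hd1 fun c _ hc => by simp [hc]]
    simp only [if_true]
    rw [Finset.sum_ite_eq', if_pos hd2]
  rw [h1, h2, h3]
  simp only [← Finset.mul_sum]
  ring

end

/-! ### Low coefficients of products of power series -/

section LowCoefficients

variable (p q : PowerSeries ℝ)

theorem PowerSeries.coeff_zero_mul' : PowerSeries.coeff 0 (p * q) =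
    PowerSeries.coeff 0 p * PowerSeries.coeff 0 q := by
  simp [PowerSeries.coeff_mul]

theorem PowerSeries.coeff_one_mul' : PowerSeries.coeff 1 (p * q) =
    PowerSeries.coeff 0 p * PowerSeries.coeff 1 q +
    PowerSeries.coeff 1 p * PowerSeries.coeff 0 q := by
  rw [PowerSeries.coeff_mul, Finset.Nat.sum_antidiagonal_eq_sum_range_succ_mk]
  simp [Finset.sum_range_succ]

theorem PowerSeries.coeff_two_mul' : PowerSeries.coeff 2 (p * q) =
    PowerSeries.coeff 0 p * PowerSeries.coeff 2 q +
    PowerSeries.coeff 1 p * PowerSeries.coeff 1 q +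
    PowerSeries.coeff 2 p * PowerSeries.coeff 0 q := by
  rw [PowerSeries.coeff_mul, Finset.Nat.sum_antidiagonal_eq_sum_range_succ_mk]
  simp [Finset.sum_range_succ]

theorem PowerSeries.coeff_three_mul' : PowerSeries.coeff 3 (p * q) =
    PowerSeries.coeff 0 p * PowerSeries.coeff 3 q +
    PowerSeries.coeff 1 p * PowerSeries.coeff 2 q +
    PowerSeries.coeff 2 p * PowerSeries.coeff 1 q +
    PowerSeries.coeff 3 p * PowerSeries.coeff 0 q := by
  rw [PowerSeries.coeff_mul, Finset.Nat.sum_antidiagonal_eq_sum_range_succ_mk]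
  simp [Finset.sum_range_succ]

theorem PowerSeries.coeff_one_X_mul' : PowerSeries.coeff 1 (PowerSeries.X * p) =
    PowerSeries.coeff 0 p := PowerSeries.coeff_succ_X_mul 0 p

theorem PowerSeries.coeff_two_X_mul' : PowerSeries.coeff 2 (PowerSeries.X * p) =
    PowerSeries.coeff 1 p := PowerSeries.coeff_succ_X_mul 1 p

end LowCoefficients

/-! ### Expansion of the deviations -/

/-- The expansion of the normalized power sums over the digits other than `d`. -/
noncomputable def digitPowSumSeries (d p : ℕ) : PowerSeries ℝ :=
  ∑ i ∈ Finset.range (p + 1),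
    PowerSeries.C ((bernoulli i : ℝ) * (p + 1).choose i / (p + 1)) * PowerSeries.X ^ i -
  PowerSeries.C ((d : ℝ) ^ p) * PowerSeries.X ^ (p + 1)

/-- Faulhaber's formula, minus the term of the digit d. -/
theorem hasInvPowExpansion_digitPowSum (d p : ℕ) :
    HasInvPowExpansion (fun b => (∑ a ∈ (Finset.range b).erase d, (a : ℝ) ^ p) *
      ((b : ℝ)⁻¹) ^ (p + 1)) (digitPowSumSeries d p) := by
  have h1 := (HasInvPowExpansion.sum (s := Finset.range (p + 1)) fun i _ =>
    (HasInvPowExpansion.inv_pow i).const_mul ((bernoulli i : ℝ) * (p + 1).choose i / (p + 1))).sub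
    ((HasInvPowExpansion.inv_pow (p + 1)).const_mul ((d : ℝ) ^ p))
  refine h1.congr_fun' ?_
  filter_upwards [eventually_gt_atTop d] with b hb
  have hb0 : (b : ℝ) ≠ 0 := by exact_mod_cast (by omega : b ≠ 0)
  have h2 : ∑ a ∈ Finset.range b, (a : ℝ) ^ p =
      ∑ i ∈ Finset.range (p + 1),
        (bernoulli i : ℝ) * (p + 1).choose i * (b : ℝ) ^ (p + 1 - i) / (p + 1) := by
    exact_mod_cast congrArg (fun q : ℚ => (q : ℝ)) (sum_range_pow b p)
  rw [← Finset.sum_erase_add _ _ (Finset.mem_range.2 hb)] at h2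
  rw [eq_sub_of_add_eq h2, sub_mul, Finset.sum_mul]
  congr 1
  refine Finset.sum_congr rfl fun i hi => ?_
  have h3 : (b : ℝ) ^ (p + 1 - i) * ((b : ℝ)⁻¹) ^ (p + 1) = ((b : ℝ)⁻¹) ^ i := by
    have : p + 1 = (p + 1 - i) + i := by have := Finset.mem_range.1 hi; omega
    conv_lhs => rw [this, pow_add, Nat.add_sub_cancel, ← mul_assoc, ← mul_pow,
      mul_inv_cancel₀ hb0, one_pow, one_mul]
  rw [← h3]
  ring

theorem coeff_zero_digitPowSumSeries (d p : ℕ) :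
    PowerSeries.coeff 0 (digitPowSumSeries d p) = 1 / (p + 1) := by
  simp [digitPowSumSeries, Finset.sum_range_succ']

theorem coeff_one_digitPowSumSeries_one (d : ℕ) :
    PowerSeries.coeff 1 (digitPowSumSeries d 1) = -1 / 2 := by
  rw [digitPowSumSeries, map_sub, Finset.sum_range_succ, Finset.sum_range_one, map_add]
  simp only [PowerSeries.coeff_C_mul, PowerSeries.coeff_X_pow]
  norm_num [bernoulli_one]

/-- The deviation of the moments, normalized to have a finite limit as `b → ∞`. -/
noncomputable def scaledDeviation (d K m b : ℕ) : ℝ :=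
  (b : ℝ) ^ (2 * K) * (b : ℝ)⁻¹ * irwinDeviation b d K m

/-- The term j = m + 1 has coefficient b - 1 and is moved to the left; division by b^(m+2) produces
the left factor. The lower level enters with b^2 b^(-m-2) = b^(-m), which for the first moment (m =
0) is 1: this is why each level is normalized by a further b^2. -/
theorem scaledDeviation_succ {b d : ℕ} (hd : 0 < d) (hdb : d < b) (K m : ℕ) :
    (1 - ((b : ℝ)⁻¹) ^ (m + 1) + ((b : ℝ)⁻¹) ^ (m + 2)) * scaledDeviation d (K + 1) (m + 1) b =
      ∑ j ∈ Finset.range (m + 1), ((m + 1).choose j : ℝ) * (((b : ℝ)⁻¹) ^ j *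
        (((∑ a ∈ (Finset.range b).erase d, (a : ℝ) ^ (m + 1 - j)) *
          ((b : ℝ)⁻¹) ^ (m + 1 - j + 1)) * scaledDeviation d (K + 1) j b)) +
      ((b : ℝ)⁻¹) ^ m * ∑ j ∈ Finset.range (m + 2),
        ((d : ℝ) ^ (m + 1 - j) * (m + 1).choose j) * scaledDeviation d K j b := by
  have hb0 : (b : ℝ) ≠ 0 := by exact_mod_cast (by omega : b ≠ 0)
  have hX : ((b : ℝ)⁻¹) * b = 1 := inv_mul_cancel₀ hb0
  have h1 := irwinDeviation_succ hd hdb K (m := m + 1) (by omega)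
  rw [Finset.sum_range_succ] at h1
  have hcard : ∑ a ∈ (Finset.range b).erase d, (a : ℝ) ^ (m + 1 - (m + 1)) = b - 1 := by
    simp only [Nat.sub_self, pow_zero, Finset.sum_const, nsmul_eq_mul, mul_one]
    rw [Finset.card_erase_of_mem (Finset.mem_range.2 hdb), Finset.card_range,
      Nat.cast_sub (by omega), Nat.cast_one]
  rw [hcard, Nat.choose_self, Nat.cast_one, mul_one] at h1
  set X := (b : ℝ)⁻¹ with hXdef
  have e1 : ∑ j ∈ Finset.range (m + 1), ((m + 1).choose j : ℝ) * (X ^ j *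
        (((∑ a ∈ (Finset.range b).erase d, (a : ℝ) ^ (m + 1 - j)) *
          X ^ (m + 1 - j + 1)) * scaledDeviation d (K + 1) j b)) =
      ((b : ℝ) ^ (2 * (K + 1)) * X * X ^ (m + 2)) * ∑ j ∈ Finset.range (m + 1),
        (∑ a ∈ (Finset.range b).erase d, (a : ℝ) ^ (m + 1 - j)) *
        (m + 1).choose j * irwinDeviation b d (K + 1) j := by
    rw [Finset.mul_sum]
    refine Finset.sum_congr rfl fun j hj => ?_
    have : X ^ (m + 2) = X ^ j * X ^ (m + 1 - j + 1) := by
      rw [← pow_add]; congr 1; have := Finset.mem_range.1 hj; omega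
    rw [this, scaledDeviation]
    ring
  have e2 : X ^ m * ∑ j ∈ Finset.range (m + 2),
        ((d : ℝ) ^ (m + 1 - j) * (m + 1).choose j) * scaledDeviation d K j b =
      ((b : ℝ) ^ (2 * (K + 1)) * X * X ^ (m + 2)) * ∑ j ∈ Finset.range (m + 2),
        (d : ℝ) ^ (m + 1 - j) * (m + 1).choose j * irwinDeviation b d K j := by
    rw [Finset.mul_sum, Finset.mul_sum]
    refine Finset.sum_congr rfl fun j hj => ?_
    have : (b : ℝ) ^ (2 * (K + 1)) * X ^ (m + 2) = (b : ℝ) ^ (2 * K) * X ^ m * (X * b) ^ 2 := by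
      ring
    rw [hX, one_pow, mul_one] at this
    rw [scaledDeviation, ← hXdef]
    linear_combination (-X * (d : ℝ) ^ (m + 1 - j) * (m + 1).choose j *
      irwinDeviation b d K j) * this
  rw [e1, e2, ← mul_add]
  have h2 : X ^ (m + 2) * (b : ℝ) ^ (m + 2) = 1 := by rw [← mul_pow, hX, one_pow]
  rw [scaledDeviation, ← hXdef]
  linear_combination ((b : ℝ) ^ (2 * (K + 1)) * X * X ^ (m + 2)) * h1 -
    ((b : ℝ) ^ (2 * (K + 1)) * X * irwinDeviation b d (K + 1) (m + 1)) * h2 +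
    ((b : ℝ) ^ (2 * (K + 1)) * X * irwinDeviation b d (K + 1) (m + 1) * X ^ (m + 1)) * hX

theorem hasInvPowExpansion_scaledDeviation_zero_left (d m : ℕ) :
    HasInvPowExpansion (scaledDeviation d 0 m) (PowerSeries.C (-(1 / (m + 1) : ℝ))) := by
  refine (HasInvPowExpansion.const _).congr_fun' ?_
  filter_upwards [eventually_gt_atTop 0] with b hb
  have hb0 : (b : ℝ) ≠ 0 := by positivity
  rw [scaledDeviation, irwinDeviation_zero_left]
  field_simp
  simp

theorem hasInvPowExpansion_scaledDeviation_succ_zero {d : ℕ} (hd : 0 < d) (K : ℕ) :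
    HasInvPowExpansion (scaledDeviation d (K + 1) 0) 0 := by
  have h : HasInvPowExpansion (fun _ => 0) 0 := by simpa using HasInvPowExpansion.const 0
  refine h.congr_fun' ?_
  filter_upwards [eventually_gt_atTop d] with b hb
  rw [scaledDeviation, irwinDeviation_succ_zero hd hb, mul_zero]

theorem hasInvPowExpansion_one_sub_inv_pow_add_inv_pow (m : ℕ) :
    HasInvPowExpansion (fun b => 1 - ((b : ℝ)⁻¹) ^ (m + 1) + ((b : ℝ)⁻¹) ^ (m + 2))
      (1 - PowerSeries.X ^ (m + 1) + PowerSeries.X ^ (m + 2)) := by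
  simpa using ((HasInvPowExpansion.const 1).sub (HasInvPowExpansion.inv_pow (m + 1))).add
    (HasInvPowExpansion.inv_pow (m + 2))

theorem hasInvPowExpansion_scaledDeviation_rhs {d K m : ℕ} {P Q : ℕ → PowerSeries ℝ}
    (hP : ∀ j < m + 1, HasInvPowExpansion (scaledDeviation d (K + 1) j) (P j))
    (hQ : ∀ j, HasInvPowExpansion (scaledDeviation d K j) (Q j)) :
    HasInvPowExpansion (fun b => ∑ j ∈ Finset.range (m + 1), ((m + 1).choose j : ℝ) *
        (((b : ℝ)⁻¹) ^ j * (((∑ a ∈ (Finset.range b).erase d, (a : ℝ) ^ (m + 1 - j)) *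
          ((b : ℝ)⁻¹) ^ (m + 1 - j + 1)) * scaledDeviation d (K + 1) j b)) +
      ((b : ℝ)⁻¹) ^ m * ∑ j ∈ Finset.range (m + 2),
        ((d : ℝ) ^ (m + 1 - j) * (m + 1).choose j) * scaledDeviation d K j b)
      (∑ j ∈ Finset.range (m + 1), PowerSeries.C ((m + 1).choose j : ℝ) *
        (PowerSeries.X ^ j * (digitPowSumSeries d (m + 1 - j) * P j)) +
      PowerSeries.X ^ m * ∑ j ∈ Finset.range (m + 2),
        PowerSeries.C ((d : ℝ) ^ (m + 1 - j) * (m + 1).choose j) * Q j) :=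
  (HasInvPowExpansion.sum fun j hj =>
    (((hasInvPowExpansion_digitPowSum d (m + 1 - j)).mul
      (hP j (Finset.mem_range.1 hj))).inv_pow_mul j).const_mul _).add
  ((HasInvPowExpansion.sum fun j _ => (hQ j).const_mul _).inv_pow_mul m)

/-- Outer induction on the level, inner strong induction on the moment. The left factor of the
recurrence has constant term 1, so it can be inverted. -/
theorem exists_hasInvPowExpansion_scaledDeviation {d : ℕ} (hd : 0 < d) (K : ℕ) :
    ∀ m, ∃ p, HasInvPowExpansion (scaledDeviation d K m) p := by
  induction K with
  | zero => exact fun m => ⟨_, hasInvPowExpansion_scaledDeviation_zero_left d m⟩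
  | succ K ihK =>
    choose Q hQ using ihK
    intro m
    induction m using Nat.strong_induction_on with
    | _ m ih =>
      cases m with
      | zero => exact ⟨0, hasInvPowExpansion_scaledDeviation_succ_zero hd K⟩
      | succ m =>
        choose! P hP using ih
        have h1 := (hasInvPowExpansion_one_sub_inv_pow_add_inv_pow m).inv (by simp)
        refine ⟨_, (h1.mul (hasInvPowExpansion_scaledDeviation_rhs hP hQ)).congr_fun' ?_⟩
        filter_upwards [eventually_gt_atTop d] with b hb
        have hb1 : (1 : ℝ) < b := by exact_mod_cast (by omega : 1 < b)
        have hne : 1 - ((b : ℝ)⁻¹) ^ (m + 1) + ((b : ℝ)⁻¹) ^ (m + 2) ≠ 0 := by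
          have h2 : ((b : ℝ)⁻¹) ^ (m + 1) < 1 :=
            pow_lt_one₀ (by positivity) (inv_lt_one_of_one_lt₀ hb1) (by omega)
          have h3 : 0 < ((b : ℝ)⁻¹) ^ (m + 2) := by positivity
          exact (by linarith : 0 < 1 - ((b : ℝ)⁻¹) ^ (m + 1) + ((b : ℝ)⁻¹) ^ (m + 2)).ne'
        rw [← scaledDeviation_succ hd hb, inv_mul_cancel_left₀ hne]

/-- The asymptotic expansion of `scaledDeviation d K m`. -/
noncomputable def deviationSeries {d : ℕ} (hd : 0 < d) (K m : ℕ) : PowerSeries ℝ :=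
  (exists_hasInvPowExpansion_scaledDeviation hd K m).choose

section DeviationSeries

variable {d : ℕ} (hd : 0 < d)

theorem hasInvPowExpansion_scaledDeviation (K m : ℕ) :
    HasInvPowExpansion (scaledDeviation d K m) (deviationSeries hd K m) :=
  (exists_hasInvPowExpansion_scaledDeviation hd K m).choose_spec

theorem deviationSeries_zero_left (m : ℕ) :
    deviationSeries hd 0 m = PowerSeries.C (-(1 / (m + 1) : ℝ)) :=
  (hasInvPowExpansion_scaledDeviation hd 0 m).unique
    (hasInvPowExpansion_scaledDeviation_zero_left d m)

theorem deviationSeries_succ_zero (K : ℕ) : deviationSeries hd (K + 1) 0 = 0 :=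
  (hasInvPowExpansion_scaledDeviation hd (K + 1) 0).unique
    (hasInvPowExpansion_scaledDeviation_succ_zero hd K)

theorem deviationSeries_succ (K m : ℕ) :
    (1 - PowerSeries.X ^ (m + 1) + PowerSeries.X ^ (m + 2)) * deviationSeries hd (K + 1) (m + 1) =
      ∑ j ∈ Finset.range (m + 1), PowerSeries.C ((m + 1).choose j : ℝ) *
        (PowerSeries.X ^ j * (digitPowSumSeries d (m + 1 - j) * deviationSeries hd (K + 1) j)) +
      PowerSeries.X ^ m * ∑ j ∈ Finset.range (m + 2),
        PowerSeries.C ((d : ℝ) ^ (m + 1 - j) * (m + 1).choose j) * deviationSeries hd K j := by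
  refine HasInvPowExpansion.unique
    ((hasInvPowExpansion_one_sub_inv_pow_add_inv_pow m).mul
      (hasInvPowExpansion_scaledDeviation hd (K + 1) (m + 1)))
    ((hasInvPowExpansion_scaledDeviation_rhs
      (fun j _ => hasInvPowExpansion_scaledDeviation hd (K + 1) j)
      (fun j => hasInvPowExpansion_scaledDeviation hd K j)).congr_fun' ?_)
  filter_upwards [eventually_gt_atTop d] with b hb
  exact (scaledDeviation_succ hd hb K m).symm

/-- Every surviving term on the right of the recurrence carries a power of X: the j = 0 term
vanishes because the mass is exactly b, and the lower level comes with X^(m-1). -/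
theorem coeff_zero_deviationSeries_of_two_le (K : ℕ) {m : ℕ} (hm : 2 ≤ m) :
    PowerSeries.coeff 0 (deviationSeries hd (K + 1) m) = 0 := by
  obtain ⟨m, rfl⟩ := Nat.exists_eq_add_of_le' hm
  have h := congrArg (PowerSeries.constantCoeff (R := ℝ)) (deviationSeries_succ hd K (m + 1))
  rw [Finset.sum_range_succ', deviationSeries_succ_zero] at h
  simpa using h

theorem deviationSeries_one_succ (K : ℕ) :
    deviationSeries hd (K + 1) 1 = (PowerSeries.X - PowerSeries.X ^ 2) *
      deviationSeries hd (K + 1) 1 + (PowerSeries.C (d : ℝ) * deviationSeries hd K 0 +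
        deviationSeries hd K 1) := by
  have h := deviationSeries_succ hd K 0
  simp [Finset.sum_range_succ, deviationSeries_succ_zero] at h
  rw [map_natCast]
  linear_combination h

/-- The recurrence for the first moment solves to -(d + 1/2) (1 - X + X^2)^(-(K+1)), whose
coefficients these are. The factor -(d + 1/2) comes from level 0, whose moments deviate by -b and
-b/2. -/
theorem coeff_deviationSeries_one (K : ℕ) :
    PowerSeries.coeff 0 (deviationSeries hd (K + 1) 1) = -(d + 1 / 2 : ℝ) ∧
    PowerSeries.coeff 1 (deviationSeries hd (K + 1) 1) = -(d + 1 / 2 : ℝ) * (K + 1) ∧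
    PowerSeries.coeff 2 (deviationSeries hd (K + 1) 1) = -(d + 1 / 2 : ℝ) * ((K + 1) * K / 2) ∧
    PowerSeries.coeff 3 (deviationSeries hd (K + 1) 1) =
      -(d + 1 / 2 : ℝ) * ((K + 1) * K * (K - 1) / 6 - (K + 1)) := by
  have key : ∀ K, PowerSeries.coeff 0 (deviationSeries hd (K + 1) 1) =
      PowerSeries.coeff 0 (PowerSeries.C (d : ℝ) * deviationSeries hd K 0 +
        deviationSeries hd K 1) ∧
      PowerSeries.coeff 1 (deviationSeries hd (K + 1) 1) =
        PowerSeries.coeff 0 (deviationSeries hd (K + 1) 1) +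
        PowerSeries.coeff 1 (PowerSeries.C (d : ℝ) * deviationSeries hd K 0 +
          deviationSeries hd K 1) ∧
      ∀ n, PowerSeries.coeff (n + 2) (deviationSeries hd (K + 1) 1) =
        PowerSeries.coeff (n + 1) (deviationSeries hd (K + 1) 1) -
        PowerSeries.coeff n (deviationSeries hd (K + 1) 1) +
        PowerSeries.coeff (n + 2) (PowerSeries.C (d : ℝ) * deviationSeries hd K 0 +
          deviationSeries hd K 1) := by
    intro K
    have h := deviationSeries_one_succ hd K
    set D := deviationSeries hd (K + 1) 1
    set R := PowerSeries.C (d : ℝ) * deviationSeries hd K 0 + deviationSeries hd K 1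
    have h' : D = PowerSeries.X * D - PowerSeries.X ^ 2 * D + R := by linear_combination h
    refine ⟨?_, ?_, fun n => ?_⟩
    · have := congrArg (PowerSeries.coeff 0) h'
      simpa using this
    · have := congrArg (PowerSeries.coeff 1) h'
      rw [map_add, map_sub, ← zero_add 1, PowerSeries.coeff_succ_X_mul,
        PowerSeries.coeff_X_pow_mul'] at this
      simpa using this
    · have := congrArg (PowerSeries.coeff (n + 2)) h'
      rwa [map_add, map_sub, PowerSeries.coeff_succ_X_mul, PowerSeries.coeff_X_pow_mul] at this
  induction K with
  | zero =>
    obtain ⟨h0, h1, h2⟩ := key 0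
    have e : PowerSeries.C (d : ℝ) * deviationSeries hd 0 0 + deviationSeries hd 0 1 =
        PowerSeries.C (-(d + 1 / 2 : ℝ)) := by
      rw [deviationSeries_zero_left, deviationSeries_zero_left, ← map_mul, ← map_add]
      congr 1
      push_cast
      ring
    rw [e] at h0 h1 h2
    have h3 := h2 0
    have h4 := h2 1
    simp only [PowerSeries.coeff_C, zero_add, Nat.reduceAdd, if_true, one_ne_zero, two_ne_zero,
      three_ne_zero, if_false, add_zero] at h0 h1 h3 h4 ⊢
    refine ⟨h0, ?_, ?_, ?_⟩
    · rw [h1, h0]; push_cast; ring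
    · rw [h3, h1, h0]; push_cast; ring
    · rw [h4, h3, h1, h0]; push_cast; ring
  | succ K ih =>
    obtain ⟨i0, i1, i2, i3⟩ := ih
    obtain ⟨h0, h1, h2⟩ := key (K + 1)
    have h3 := h2 0
    have h4 := h2 1
    rw [deviationSeries_succ_zero, mul_zero, zero_add] at h0 h1 h3 h4
    simp only [zero_add, Nat.reduceAdd] at h3 h4
    rw [i0] at h0
    rw [h0, i1] at h1
    rw [h1, h0, i2] at h3
    rw [h3, h1, i3] at h4
    refine ⟨h0, ?_, ?_, ?_⟩
    · rw [h1]; push_cast; ring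
    · rw [h3]; push_cast; ring
    · rw [h4]; push_cast; ring

theorem deviationSeries_two_succ (K : ℕ) :
    deviationSeries hd (K + 1) 2 = (PowerSeries.X ^ 2 - PowerSeries.X ^ 3) *
      deviationSeries hd (K + 1) 2 +
      PowerSeries.X * (PowerSeries.C 2 * (digitPowSumSeries d 1 * deviationSeries hd (K + 1) 1) +
        (PowerSeries.C ((d : ℝ) ^ 2) * deviationSeries hd K 0 +
          PowerSeries.C (2 * d : ℝ) * deviationSeries hd K 1 + deviationSeries hd K 2)) := by
  have h := deviationSeries_succ hd K 1
  simp only [Finset.sum_range_succ, deviationSeries_succ_zero, Finset.range_zero,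
    Finset.sum_empty] at h
  simp at h
  simp only [map_mul, map_pow, map_natCast, map_ofNat] at h ⊢
  linear_combination h

/-- The case K = 0 is special because level 0 deviates in all moments, giving minus the integral of
(d + x)^2 over [0,1]; at later levels only the first moment has a nonzero constant coefficient. The
two cases differ by d^2 - 1/3, the numerator of the exceptional term at k = 3. -/
theorem coeff_one_deviationSeries_two (K : ℕ) :
    PowerSeries.coeff 1 (deviationSeries hd (K + 1) 2) = -(d + 1 / 2 : ℝ) +
      (if K = 0 then -(d ^ 2 + d + 1 / 3 : ℝ) else -(2 * d * (d + 1 / 2) : ℝ)) := by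
  have h := congrArg (PowerSeries.coeff 1) (deviationSeries_two_succ hd K)
  rw [sub_mul, map_add, map_sub, PowerSeries.coeff_X_pow_mul', PowerSeries.coeff_X_pow_mul',
    if_neg (by omega), if_neg (by omega), PowerSeries.coeff_one_X_mul'] at h
  rw [h]
  have h1 := (coeff_deviationSeries_one hd K).1
  have h2 := coeff_zero_digitPowSumSeries d 1
  simp only [PowerSeries.coeff_zero_eq_constantCoeff] at h1 h2
  simp only [PowerSeries.coeff_zero_eq_constantCoeff, map_add, map_mul,
    PowerSeries.constantCoeff_C, h1, h2]
  split_ifs with hK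
  · subst hK
    simp only [deviationSeries_zero_left, PowerSeries.constantCoeff_C]
    push_cast
    ring
  · obtain ⟨K, rfl⟩ := Nat.exists_eq_succ_of_ne_zero hK
    have h3 := (coeff_deviationSeries_one hd K).1
    have h4 := coeff_zero_deviationSeries_of_two_le hd K le_rfl
    simp only [PowerSeries.coeff_zero_eq_constantCoeff] at h3 h4
    simp only [Nat.succ_eq_add_one, deviationSeries_succ_zero, h3, h4, map_zero]
    push_cast
    ring

theorem coeff_two_deviationSeries_two (K : ℕ) :
    PowerSeries.coeff 2 (deviationSeries hd (K + 2) 2) = -(d + 1 / 2 : ℝ) * (K + 1) -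
      2 * d * (d + 1 / 2) * (K + 1) + PowerSeries.coeff 1 (deviationSeries hd (K + 1) 2) := by
  have h := congrArg (PowerSeries.coeff 2) (deviationSeries_two_succ hd (K + 1))
  have h1 := coeff_deviationSeries_one hd (K + 1)
  have h2 := coeff_zero_deviationSeries_of_two_le hd (K + 1) le_rfl
  rw [sub_mul, map_add, map_sub, PowerSeries.coeff_X_pow_mul', PowerSeries.coeff_X_pow_mul',
    if_pos le_rfl, if_neg (by omega), Nat.sub_self, h2, PowerSeries.coeff_two_X_mul',
    deviationSeries_succ_zero] at h
  simp only [map_add, PowerSeries.coeff_C_mul, mul_zero, map_zero] at h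
  rw [h, PowerSeries.coeff_one_mul']
  rw [h1.1, h1.2.1, coeff_zero_digitPowSumSeries, coeff_one_digitPowSumSeries_one,
    (coeff_deviationSeries_one hd K).2.1]
  push_cast
  ring

/-- To first order only the first moment at the same level contributes, with weight 3 · (1/3). -/
theorem coeff_one_deviationSeries_three (K : ℕ) :
    PowerSeries.coeff 1 (deviationSeries hd (K + 1) 3) = -(d + 1 / 2 : ℝ) := by
  have h := congrArg (PowerSeries.coeff 1) (deviationSeries_succ hd K 2)
  have h1 := (coeff_deviationSeries_one hd K).1
  have h2 := coeff_zero_digitPowSumSeries d 2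
  rw [Finset.sum_range_succ, Finset.sum_range_succ, Finset.sum_range_one,
    deviationSeries_succ_zero, add_mul, sub_mul, one_mul] at h
  simp only [map_add, map_sub, PowerSeries.coeff_C_mul, PowerSeries.coeff_X_pow_mul'] at h
  simp only [PowerSeries.coeff_zero_eq_constantCoeff] at h1 h2
  simp [h1, h2] at h
  rw [h]
  ring

end DeviationSeries

/-! ### Sums over the two leading digits: row, bulk, corner and column -/

theorem hasInvPowExpansion_zetaTail_const_mul {c r : ℕ} (hc : 0 < c) (hr : r ≠ 0) :
    HasInvPowExpansion (fun b => zetaTail (r + 1) (c * b))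
      (PowerSeries.X ^ r * (PowerSeries.C (((c : ℝ)⁻¹) ^ r) *
        PowerSeries.rescale ((c : ℝ)⁻¹) (zetaTailSeries r))) := by
  refine ((((hasInvPowExpansion_scaledZetaTail hr).comp_const_mul hc).const_mul
    (((c : ℝ)⁻¹) ^ r)).inv_pow_mul r).congr_fun' ?_
  filter_upwards [eventually_gt_atTop 0] with b hb
  rw [zetaTail_eq_inv_pow_mul r (Nat.mul_pos hc hb)]
  push_cast
  rw [mul_inv, mul_pow]
  ring

/-- The normalized expansion of the sum of `n ^ (-r - 1)` over `c b ≤ n < (c + 1) b`. -/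
noncomputable def rowSeries (c r : ℕ) : PowerSeries ℝ :=
  PowerSeries.C (((c : ℝ)⁻¹) ^ r) * PowerSeries.rescale ((c : ℝ)⁻¹) (zetaTailSeries r) -
  PowerSeries.C ((((c + 1 : ℕ) : ℝ)⁻¹) ^ r) *
    PowerSeries.rescale (((c + 1 : ℕ) : ℝ)⁻¹) (zetaTailSeries r)

theorem hasInvPowExpansion_row {c r : ℕ} (hc : 0 < c) (hr : r ≠ 0) :
    HasInvPowExpansion (fun b => ∑ a ∈ Finset.range b, (((c * b + a : ℕ) : ℝ)⁻¹) ^ (r + 1))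
      (PowerSeries.X ^ r * rowSeries c r) := by
  rw [rowSeries, mul_sub]
  refine ((hasInvPowExpansion_zetaTail_const_mul hc hr).sub
    (hasInvPowExpansion_zetaTail_const_mul c.succ_pos hr)).congr_fun'
    (Eventually.of_forall fun b => ?_)
  have h1 := sum_Ico_inv_pow_eq_zetaTail_sub (s := r + 1) (by omega)
    (Nat.mul_le_mul_right b c.le_succ)
  rw [Finset.sum_Ico_eq_sum_range] at h1
  rw [Nat.succ_mul, Nat.add_sub_cancel_left] at h1
  simp only [h1, Nat.succ_mul]

theorem coeff_rowSeries (c r n : ℕ) : PowerSeries.coeff n (rowSeries c r) =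
    (((c : ℝ)⁻¹) ^ (r + n) - (((c + 1 : ℕ) : ℝ)⁻¹) ^ (r + n)) *
      PowerSeries.coeff n (zetaTailSeries r) := by
  rw [rowSeries, map_sub, PowerSeries.coeff_C_mul, PowerSeries.coeff_C_mul,
    PowerSeries.coeff_rescale, PowerSeries.coeff_rescale]
  ring

/-- The difference of the tails at b and b^2; the latter is smaller by a factor b^(-r), so its
series `q` may stay unspecified. -/
theorem exists_hasInvPowExpansion_sum_Ico_sq {r : ℕ} (hr : r ≠ 0) :
    ∃ q, HasInvPowExpansion (fun b => ∑ n ∈ Finset.Ico b (b ^ 2), ((n : ℝ)⁻¹) ^ (r + 1))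
      (PowerSeries.X ^ r * (zetaTailSeries r - PowerSeries.X ^ r * q)) := by
  obtain ⟨q, hq⟩ := (hasInvPowExpansion_scaledZetaTail hr).exists_comp_sq
  refine ⟨q, (((hasInvPowExpansion_scaledZetaTail hr).sub (hq.inv_pow_mul r)).inv_pow_mul
    r).congr_fun' ?_⟩
  filter_upwards [eventually_gt_atTop 0] with b hb
  rw [sum_Ico_inv_pow_eq_zetaTail_sub (by omega) (Nat.le_self_pow two_ne_zero b),
    zetaTail_eq_inv_pow_mul r hb, zetaTail_eq_inv_pow_mul r (pow_pos hb 2)]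
  push_cast
  rw [← inv_pow, ← pow_mul]
  ring

/-- The normalized expansion of `(d b + d) ^ (-s)`. -/
noncomputable def cornerSeries (d s : ℕ) : PowerSeries ℝ :=
  PowerSeries.C (((d : ℝ)⁻¹) ^ s) * negBinomSeries s

theorem hasInvPowExpansion_corner {d : ℕ} (s : ℕ) :
    HasInvPowExpansion (fun b => ((b : ℝ) * ((d * b + d : ℕ) : ℝ)⁻¹) ^ s)
      (cornerSeries d s) := by
  refine ((hasInvPowExpansion_one_add_inv_pow_inv s).const_mul _).congr_fun' ?_
  filter_upwards [eventually_gt_atTop 0] with b hb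
  have hb0 : (b : ℝ) ≠ 0 := by positivity
  have h1 : 1 + (b : ℝ)⁻¹ = ((b : ℝ) + 1) * (b : ℝ)⁻¹ := by field_simp
  push_cast
  rw [show (d : ℝ) * b + d = d * (b + 1) by ring, h1, mul_inv, mul_pow, mul_pow, mul_pow, mul_inv,
    inv_pow, inv_pow, inv_inv, inv_pow]
  ring

theorem hasInvPowExpansion_sum_Ico_one {r : ℕ} (hr : r ≠ 0) :
    HasInvPowExpansion (fun b => ∑ c ∈ Finset.Ico 1 b, ((c : ℝ)⁻¹) ^ (r + 1))
      (PowerSeries.C (zetaVal (r + 1)) - PowerSeries.X ^ r * zetaTailSeries r) := by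
  refine ((HasInvPowExpansion.const _).sub
    ((hasInvPowExpansion_scaledZetaTail hr).inv_pow_mul r)).congr_fun' ?_
  filter_upwards [eventually_gt_atTop 0] with b hb
  rw [sum_Ico_inv_pow_eq_zetaTail_sub (by omega) hb, zetaTail_one_eq_zetaVal (by omega),
    zetaTail_eq_inv_pow_mul r hb]

/-- Write b/(c b + d) = c^(-1) (1 + d/(b c))^(-1) and expand in d/(b c). The Taylor remainder is at
most a constant times (d/b)^N uniformly in c, and the factor c^(-r-1) ≤ c^(-2) makes the sum over c
converge. Each term then sums to a zeta value minus a tail starting at b. -/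
theorem invPowApprox_col {d r : ℕ} (hr : r ≠ 0) (N : ℕ) :
    InvPowApprox N
      (fun b => ∑ c ∈ Finset.Ico 1 b, ((b : ℝ) * ((c * b + d : ℕ) : ℝ)⁻¹) ^ (r + 1))
      (∑ i ∈ Finset.range N, PowerSeries.C (PowerSeries.coeff i (negBinomSeries (r + 1)) *
        (d : ℝ) ^ i) * (PowerSeries.X ^ i * (PowerSeries.C (zetaVal (r + i + 1)) -
          PowerSeries.X ^ (r + i) * zetaTailSeries (r + i)))) := by
  obtain ⟨C, hC⟩ := exists_abs_one_add_pow_inv_sub_le (r + 1) N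
  -- The bound at x = 1 forces C to be nonnegative.
  have hC0 : 0 ≤ C * 1 ^ N := (abs_nonneg _).trans (hC 1 ⟨zero_le_one, le_rfl⟩)
  rw [one_pow, mul_one] at hC0
  have h1 := HasInvPowExpansion.sum (s := Finset.range N) fun i _ =>
    ((hasInvPowExpansion_sum_Ico_one (r := r + i) (by omega)).inv_pow_mul i).const_mul
      (PowerSeries.coeff i (negBinomSeries (r + 1)) * (d : ℝ) ^ i)
  suffices h2 : InvPowApprox N (fun b => ∑ c ∈ Finset.Ico 1 b,
      ((b : ℝ) * ((c * b + d : ℕ) : ℝ)⁻¹) ^ (r + 1) - ∑ i ∈ Finset.range N,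
      (PowerSeries.coeff i (negBinomSeries (r + 1)) * (d : ℝ) ^ i) *
        (((b : ℝ)⁻¹) ^ i * ∑ c ∈ Finset.Ico 1 b, ((c : ℝ)⁻¹) ^ (r + i + 1))) 0 by
    have h3 := h2.add (h1 N)
    rw [zero_add] at h3
    exact h3.congr_fun' (Eventually.of_forall fun b => by ring)
  rw [InvPowApprox.zero_iff]
  refine IsBigO.of_bound (zetaTail 2 1 * (C * (d : ℝ) ^ N)) ?_
  filter_upwards [eventually_gt_atTop d] with b hb
  have hb0 : (0 : ℝ) < b := by exact_mod_cast (by omega : 0 < b)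
  have hsum : ∑ i ∈ Finset.range N,
      (PowerSeries.coeff i (negBinomSeries (r + 1)) * (d : ℝ) ^ i) *
        (((b : ℝ)⁻¹) ^ i * ∑ c ∈ Finset.Ico 1 b, ((c : ℝ)⁻¹) ^ (r + i + 1)) =
      ∑ c ∈ Finset.Ico 1 b, ((c : ℝ)⁻¹) ^ (r + 1) *
        (PowerSeries.trunc N (negBinomSeries (r + 1))).eval (d * (b : ℝ)⁻¹ * (c : ℝ)⁻¹) := by
    simp only [PowerSeries.eval_trunc_eq_sum, Finset.mul_sum]
    rw [Finset.sum_comm]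
    exact Finset.sum_congr rfl fun c _ => Finset.sum_congr rfl fun i _ => by
      rw [mul_pow, mul_pow, add_right_comm, pow_add _ (r + 1) i]; ring
  rw [hsum, ← Finset.sum_sub_distrib, Real.norm_eq_abs,
    Real.norm_of_nonneg (by positivity)]
  refine (Finset.abs_sum_le_sum_abs _ _).trans ?_
  have hterm : ∀ c ∈ Finset.Ico 1 b, |((b : ℝ) * ((c * b + d : ℕ) : ℝ)⁻¹) ^ (r + 1) -
      ((c : ℝ)⁻¹) ^ (r + 1) * (PowerSeries.trunc N (negBinomSeries (r + 1))).eval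
        (d * (b : ℝ)⁻¹ * (c : ℝ)⁻¹)| ≤
      ((c : ℝ)⁻¹) ^ 2 * (C * (d : ℝ) ^ N * ((b : ℝ)⁻¹) ^ N) := by
    intro c hc
    have hc1 : (1 : ℝ) ≤ c := by exact_mod_cast (Finset.mem_Ico.1 hc).1
    have hc0 : (0 : ℝ) < c := by linarith
    have hci : (c : ℝ)⁻¹ ≤ 1 := inv_le_one_of_one_le₀ hc1
    set x : ℝ := d * (b : ℝ)⁻¹ * (c : ℝ)⁻¹ with hx
    have hdb1 : (d : ℝ) * (b : ℝ)⁻¹ ≤ 1 := by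
      rw [← div_eq_mul_inv, div_le_one hb0]; exact_mod_cast hb.le
    have hxle : x ≤ d * (b : ℝ)⁻¹ := mul_le_of_le_one_right (by positivity) hci
    have hx0 : 0 ≤ x := by positivity
    have h2 : ((b : ℝ) * ((c * b + d : ℕ) : ℝ)⁻¹) ^ (r + 1) =
        ((c : ℝ)⁻¹) ^ (r + 1) * ((1 + x) ^ (r + 1))⁻¹ := by
      rw [← inv_pow, ← mul_pow]
      congr 1
      push_cast
      rw [hx]
      field_simp
    rw [h2, ← mul_sub, abs_mul, abs_of_nonneg (a := ((c : ℝ)⁻¹) ^ (r + 1)) (by positivity)]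
    refine mul_le_mul (pow_le_pow_of_le_one (by positivity) hci (by omega))
      ((hC x ⟨hx0, hxle.trans hdb1⟩).trans ?_) (abs_nonneg _) (by positivity)
    rw [mul_assoc, ← mul_pow]
    exact mul_le_mul_of_nonneg_left (pow_le_pow_left₀ hx0 hxle N) hC0
  refine (Finset.sum_le_sum hterm).trans ?_
  rw [← Finset.sum_mul, sum_Ico_inv_pow_eq_zetaTail_sub le_rfl (by omega),
    mul_assoc (zetaTail 2 1)]
  have := zetaTail_nonneg 2 b
  refine mul_le_mul_of_nonneg_right (by linarith) (by positivity)

theorem exists_hasInvPowExpansion_col (d : ℕ) {r : ℕ} (hr : r ≠ 0) :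
    ∃ p, HasInvPowExpansion
      (fun b => ∑ c ∈ Finset.Ico 1 b, ((b : ℝ) * ((c * b + d : ℕ) : ℝ)⁻¹) ^ (r + 1)) p :=
  HasInvPowExpansion.exists_of_forall fun N => ⟨_, invPowApprox_col hr N⟩

/-- In the coefficient of 1/b, the -1 is the missing tail of ζ(2) beyond b, and -2 d ζ(3) is the
first Taylor correction. -/
theorem coeff_col {d : ℕ} {p : PowerSeries ℝ} (h : HasInvPowExpansion
      (fun b => ∑ c ∈ Finset.Ico 1 b, ((b : ℝ) * ((c * b + d : ℕ) : ℝ)⁻¹) ^ (1 + 1)) p) :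
    PowerSeries.coeff 0 p = zetaVal 2 ∧
    PowerSeries.coeff 1 p = -1 - 2 * d * zetaVal 3 := by
  have h1 := (h 2).coeff_eq (invPowApprox_col one_ne_zero 2)
  constructor
  · rw [h1 0 (by omega)]
    simp [Finset.sum_range_succ, coeff_zero_negBinomSeries]
  · rw [h1 1 (by omega)]
    have h2 := coeff_zero_zetaTailSeries one_ne_zero
    have h3 := coeff_one_negBinomSeries 2
    have h4 := coeff_zero_negBinomSeries 2
    simp only [Finset.sum_range_succ, Finset.range_zero, Finset.sum_empty, zero_add, map_add,
      map_sub, PowerSeries.coeff_C_mul, PowerSeries.coeff_one_X_mul', pow_zero, pow_one, one_mul,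
      add_zero, one_add_one_eq_two, h2, h3, h4, PowerSeries.coeff_C, if_true, one_ne_zero,
      if_false, PowerSeries.coeff_X_pow_mul']
    simp
    ring

/-! ### Assembling the expansion -/

/-- With K = k - 1, the corner at level K has order X^l. The row at level K + 1 loses two orders for
the level but gains one from summing b terms, hence X^(l+1); the column gains none, hence X^(l+2).
The bulk at level K + 2 has order X^(l+3). What lies beyond is collected in `q`, which the first
four coefficients never see. -/
theorem exists_hasInvPowExpansion_leadingDigits {d : ℕ} (hd : 0 < d) {K : ℕ} (hK : 1 ≤ K)
    (l : ℕ) :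
    ∃ κ q, HasInvPowExpansion (fun b => ∑ c ∈ Finset.Ico 1 b,
        ((b : ℝ) * ((c * b + d : ℕ) : ℝ)⁻¹) ^ (l + 1 + 1)) κ ∧
      HasInvPowExpansion (fun b => (b : ℝ) ^ (2 * K + 1) * ∑ n ∈ Finset.Ico b (b ^ 2),
        ((n : ℝ)⁻¹) ^ (l + 1 + 1) * irwinDeviation b d (K + 2 - digitCount b d n) (l + 1))
        (PowerSeries.X ^ l * (deviationSeries hd K (l + 1) * cornerSeries d (l + 2) +
          PowerSeries.X * (deviationSeries hd (K + 1) (l + 1) * rowSeries d (l + 1)) +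
          PowerSeries.X ^ 2 * (deviationSeries hd (K + 1) (l + 1) *
            (κ - PowerSeries.C 2 * cornerSeries d (l + 2))) +
          PowerSeries.X ^ 3 * (deviationSeries hd (K + 2) (l + 1) *
            (zetaTailSeries (l + 1) - rowSeries d (l + 1))) +
          PowerSeries.X ^ 4 * q)) := by
  have hl : l + 1 ≠ 0 := l.succ_ne_zero
  obtain ⟨κ, hκ⟩ := exists_hasInvPowExpansion_col d hl
  obtain ⟨q, hq⟩ := exists_hasInvPowExpansion_sum_Ico_sq hl
  have h0 := hasInvPowExpansion_scaledDeviation hd K (l + 1)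
  have h1 := hasInvPowExpansion_scaledDeviation hd (K + 1) (l + 1)
  have h2 := (hasInvPowExpansion_scaledDeviation hd (K + 2) (l + 1)).inv_pow_mul 2
  have hr := hasInvPowExpansion_row hd hl
  have hc := hasInvPowExpansion_corner (d := d) (l + 2)
  have h := (((h2.mul hq).add ((h1.sub h2).mul (hr.add (hκ.inv_pow_mul (l + 2))))).add
    ((h2.sub (h1.const_mul 2)).mul (hc.inv_pow_mul (l + 2)))).add
    (h0.mul (hc.inv_pow_mul l))
  refine ⟨κ, deviationSeries hd (K + 2) (l + 1) * (cornerSeries d (l + 2) - κ -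
    PowerSeries.X ^ l * q), hκ, ?_⟩
  have e : ∀ {p p' : PowerSeries ℝ} {f g : ℕ → ℝ}, HasInvPowExpansion f p → p = p' →
      f =ᶠ[atTop] g → HasInvPowExpansion g p' := fun hf hp hfg => hp ▸ hf.congr_fun' hfg
  refine e h (by ring) ?_
  filter_upwards [eventually_gt_atTop d] with b hb
  have hb0 : (b : ℝ) ≠ 0 := by exact_mod_cast (by omega : b ≠ 0)
  rw [show K + 2 = K + 1 + 1 by ring, sum_Ico_irwinDeviation hd hb (show 2 ≤ K + 1 by omega)
    (fun n => ((n : ℝ)⁻¹) ^ (l + 1 + 1)), Nat.add_sub_cancel]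
  simp only [scaledDeviation]
  have hX : (b : ℝ)⁻¹ * b = 1 := inv_mul_cancel₀ hb0
  set X := (b : ℝ)⁻¹
  have e1 : ∀ x : ℝ, X ^ (l + 2) * ((b : ℝ) * x) ^ (l + 1 + 1) = x ^ (l + 1 + 1) := fun x => by
    rw [← mul_pow, ← mul_assoc, hX, one_mul]
  have e2 : X ^ (l + 2) * ∑ c ∈ Finset.Ico 1 b,
      ((b : ℝ) * ((c * b + d : ℕ) : ℝ)⁻¹) ^ (l + 1 + 1) =
      ∑ c ∈ Finset.Ico 1 b, (((c * b + d : ℕ) : ℝ)⁻¹) ^ (l + 1 + 1) := by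
    rw [Finset.mul_sum]
    exact Finset.sum_congr rfl fun c _ => e1 _
  have e3 : X ^ l * ((b : ℝ) * ((d * b + d : ℕ) : ℝ)⁻¹) ^ (l + 2) =
      (b : ℝ) ^ 2 * (((d * b + d : ℕ) : ℝ)⁻¹) ^ (l + 1 + 1) := by
    have h3 : X ^ l * (b : ℝ) ^ l = 1 := by rw [← mul_pow, hX, one_pow]
    linear_combination ((b : ℝ) ^ 2 * (((d * b + d : ℕ) : ℝ)⁻¹) ^ (l + 2)) * h3
  have e4 : X ^ 2 * ((b : ℝ) ^ (2 * (K + 2)) * X) = (b : ℝ) ^ (2 * K + 1) := by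
    have : X ^ 2 * ((b : ℝ) ^ (2 * (K + 2)) * X) = (b : ℝ) ^ (2 * K + 1) * (X * b) ^ 3 := by ring
    rw [this, hX, one_pow, mul_one]
  have e5 : (b : ℝ) ^ (2 * (K + 1)) * X = (b : ℝ) ^ (2 * K + 1) := by
    have : (b : ℝ) ^ (2 * (K + 1)) * X = (b : ℝ) ^ (2 * K + 1) * (X * b) := by ring
    rw [this, hX, mul_one]
  have e6 : (b : ℝ) ^ (2 * K) * X * (b : ℝ) ^ 2 = (b : ℝ) ^ (2 * K + 1) := by
    have : (b : ℝ) ^ (2 * K) * X * (b : ℝ) ^ 2 = (b : ℝ) ^ (2 * K + 1) * (X * b) := by ring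
    rw [this, hX, mul_one]
  rw [e2, e1, e3, e5, ← mul_assoc (X ^ 2), e4]
  linear_combination (irwinDeviation b d K (l + 1) *
    (((d * b + d : ℕ) : ℝ)⁻¹) ^ (l + 1 + 1)) * e6

/-- The moment of index l + 1 contributes only from order X^l on, so each coefficient is a finite
sum over moments. -/
theorem exists_hasInvPowExpansion_irwinSum {d : ℕ} (hd : 0 < d) {K : ℕ} (hK : 1 ≤ K)
    {Ω : ℕ → PowerSeries ℝ}
    (hΩ : ∀ l, HasInvPowExpansion (fun b => (b : ℝ) ^ (2 * K + 1) * ∑ n ∈ Finset.Ico b (b ^ 2),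
      ((n : ℝ)⁻¹) ^ (l + 1 + 1) * irwinDeviation b d (K + 2 - digitCount b d n) (l + 1))
      (PowerSeries.X ^ l * Ω l)) :
    ∃ p, HasInvPowExpansion
      (fun b => (b : ℝ) ^ (2 * K + 1) * (irwinSum b d (K + 1) - b * Real.log b)) p ∧
      ∀ n, PowerSeries.coeff n p =
        ∑ l ∈ Finset.range (n + 1), (-1) ^ (l + 1) * PowerSeries.coeff (n - l) (Ω l) := by
  have key : ∀ N, InvPowApprox N
      (fun b => (b : ℝ) ^ (2 * K + 1) * (irwinSum b d (K + 1) - b * Real.log b))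
      (∑ l ∈ Finset.range (N + 2 * K + 2), PowerSeries.C ((-1) ^ (l + 1) : ℝ) *
        (PowerSeries.X ^ l * Ω l)) := by
    intro N
    have h1 := HasInvPowExpansion.sum (s := Finset.range (N + 2 * K + 2)) fun l _ =>
      (hΩ l).const_mul ((-1) ^ (l + 1) : ℝ)
    suffices h2 : InvPowApprox N (fun b => (b : ℝ) ^ (2 * K + 1) *
        (irwinSum b d (K + 1) - b * Real.log b) - ∑ l ∈ Finset.range (N + 2 * K + 2),
        (-1) ^ (l + 1) * ((b : ℝ) ^ (2 * K + 1) * ∑ n ∈ Finset.Ico b (b ^ 2),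
          ((n : ℝ)⁻¹) ^ (l + 1 + 1) *
            irwinDeviation b d (K + 2 - digitCount b d n) (l + 1))) 0 by
      have h3 := h2.add (h1 N)
      rw [zero_add] at h3
      exact h3.congr_fun' (Eventually.of_forall fun b => by ring)
    rw [InvPowApprox.zero_iff]
    refine IsBigO.of_bound 3 ?_
    filter_upwards [eventually_gt_atTop d] with b hb
    have hb0 : (b : ℝ) ≠ 0 := by exact_mod_cast (by omega : b ≠ 0)
    -- The number of moments makes the error b^(2K+1) b^3 b^(-(N+2K+4)) equal to b^(-N). One of them
    -- is the moment of index 0, removed next.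
    have h3 := abs_irwinSum_sub_le hd hb (show 2 ≤ K + 1 by omega) (N + 2 * K + 3)
    -- All levels that occur are at least 1, where the mass is exactly b.
    have hzero : ∑ n ∈ Finset.Ico b (b ^ 2),
        ((n : ℝ)⁻¹) ^ (0 + 1) * irwinDeviation b d (K + 1 + 1 - digitCount b d n) 0 = 0 := by
      refine Finset.sum_eq_zero fun n hn => ?_
      have := digitCount_le_two hd hb (Finset.mem_Ico.1 hn).2
      rw [show K + 1 + 1 - digitCount b d n = (K + 1 - digitCount b d n) + 1 by omega,
        irwinDeviation_succ_zero hd hb, mul_zero]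
    rw [Finset.sum_range_succ', hzero, mul_zero, add_zero] at h3
    rw [Real.norm_eq_abs, Real.norm_of_nonneg (by positivity)]
    have h4 : (b : ℝ) ^ (2 * K + 1) * ((b : ℝ) ^ 3 * ((b : ℝ)⁻¹) ^ (N + 2 * K + 3 + 1)) =
        ((b : ℝ)⁻¹) ^ N := by
      have : (b : ℝ) ^ (2 * K + 1) * ((b : ℝ) ^ 3 * ((b : ℝ)⁻¹) ^ (N + 2 * K + 3 + 1)) =
        ((b : ℝ)⁻¹) ^ N * ((b : ℝ)⁻¹ * b) ^ (2 * K + 4) := by ring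
      rw [this, inv_mul_cancel₀ hb0, one_pow, mul_one]
    have h5 := mul_le_mul_of_nonneg_left h3 (pow_nonneg (Nat.cast_nonneg (α := ℝ) b) (2 * K + 1))
    rw [← abs_of_nonneg (pow_nonneg (Nat.cast_nonneg (α := ℝ) b) (2 * K + 1)), ← abs_mul,
      abs_of_nonneg (pow_nonneg (Nat.cast_nonneg (α := ℝ) b) (2 * K + 1)),
      mul_left_comm _ (3 : ℝ), h4, mul_sub, Finset.mul_sum] at h5
    refine (le_of_eq (congrArg _ (congrArg _ ?_))).trans h5
    exact Finset.sum_congr rfl fun l _ => by ring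
  obtain ⟨p, hp⟩ := HasInvPowExpansion.exists_of_forall fun N => ⟨_, key N⟩
  refine ⟨p, hp, fun n => ?_⟩
  rw [(hp (n + 1)).coeff_eq (key (n + 1)) n n.lt_succ_self, map_sum]
  have hsub : Finset.range (n + 1) ⊆ Finset.range (n + 1 + 2 * K + 2) :=
    Finset.range_mono (by omega)
  rw [← Finset.sum_subset hsub]
  · refine Finset.sum_congr rfl fun l hl => ?_
    rw [PowerSeries.coeff_C_mul, PowerSeries.coeff_X_pow_mul',
      if_pos (Nat.lt_succ_iff.1 (Finset.mem_range.1 hl))]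
  · intro l _ hl
    rw [Finset.mem_range] at hl
    rw [PowerSeries.coeff_C_mul, PowerSeries.coeff_X_pow_mul', if_neg (by omega), mul_zero]

theorem HasInvPowExpansion.isBigO_sub_sum {f : ℕ → ℝ} {p : PowerSeries ℝ} {i : ℕ}
    (h : HasInvPowExpansion (fun b => (b : ℝ) ^ i * f b) p) (N : ℕ) :
    (fun b : ℕ => f b - ∑ n ∈ Finset.range N, PowerSeries.coeff n p / (b : ℝ) ^ (i + n))
      =O[atTop] (fun b : ℕ => 1 / (b : ℝ) ^ (i + N)) := by
  refine ((isBigO_refl (fun b : ℕ => ((b : ℝ)⁻¹) ^ i) atTop).mul (h N)).congr' ?_ ?_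
  · filter_upwards [eventually_gt_atTop 0] with b hb
    have h0 : ((b : ℝ)⁻¹) ^ i * (b : ℝ) ^ i = 1 := by
      rw [← mul_pow, inv_mul_cancel₀ (by positivity), one_pow]
    rw [PowerSeries.eval_trunc_eq_sum, mul_sub, ← mul_assoc, h0, one_mul, Finset.mul_sum]
    congr 1
    refine Finset.sum_congr rfl fun n _ => ?_
    rw [div_eq_mul_inv, ← _root_.inv_pow, pow_add]
    ring
  · exact Eventually.of_forall fun b => by simp only [one_div, _root_.inv_pow, pow_add, mul_inv]

/-! ### The first four coefficients -/

section CoeffAddShifted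

variable (A B C D E : PowerSeries ℝ)

theorem coeff_zero_add_shifted : PowerSeries.coeff 0 (A + PowerSeries.X * B +
    PowerSeries.X ^ 2 * C + PowerSeries.X ^ 3 * D + PowerSeries.X ^ 4 * E) =
    PowerSeries.coeff 0 A := by
  simp

theorem coeff_one_add_shifted : PowerSeries.coeff 1 (A + PowerSeries.X * B +
    PowerSeries.X ^ 2 * C + PowerSeries.X ^ 3 * D + PowerSeries.X ^ 4 * E) =
    PowerSeries.coeff 1 A + PowerSeries.coeff 0 B := by
  simp [PowerSeries.coeff_X_pow_mul']

theorem coeff_two_add_shifted : PowerSeries.coeff 2 (A + PowerSeries.X * B +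
    PowerSeries.X ^ 2 * C + PowerSeries.X ^ 3 * D + PowerSeries.X ^ 4 * E) =
    PowerSeries.coeff 2 A + PowerSeries.coeff 1 B + PowerSeries.coeff 0 C := by
  simp [PowerSeries.coeff_X_pow_mul']

theorem coeff_three_add_shifted : PowerSeries.coeff 3 (A + PowerSeries.X * B +
    PowerSeries.X ^ 2 * C + PowerSeries.X ^ 3 * D + PowerSeries.X ^ 4 * E) =
    PowerSeries.coeff 3 A + PowerSeries.coeff 2 B + PowerSeries.coeff 1 C +
      PowerSeries.coeff 0 D := by
  simp [PowerSeries.coeff_X_pow_mul']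

end CoeffAddShifted

theorem coeff_cornerSeries (d s n : ℕ) : PowerSeries.coeff n (cornerSeries d s) =
    ((d : ℝ)⁻¹) ^ s * PowerSeries.coeff n (negBinomSeries s) :=
  PowerSeries.coeff_C_mul _ _ _

theorem mainTheorem7 (d k : ℕ) (hd : 0 < d) (hk : 3 ≤ k) :
    (∀ b : ℕ, d < b → Summable (fun m : irwinSet b d k => 1 / ((m : ℕ) : ℝ))) ∧
    ∃ a : ℕ → ℝ,
      (∀ N : ℕ,
        (fun b : ℕ => irwinSum b d k - (b : ℝ) * Real.log (b : ℝ)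
            - ∑ n ∈ Finset.range N, a n / (b : ℝ) ^ (2 * k - 1 + n))
          =O[atTop] (fun b : ℕ => 1 / (b : ℝ) ^ (2 * k - 1 + N))) ∧
      a 0 = ((d : ℝ) + 1 / 2) / (d : ℝ) ^ 2 ∧
      a 1 = ((d : ℝ) + 1 / 2) * (((k : ℝ) - 2) * (d : ℝ) + (k : ℝ) - 3)
          / ((d : ℝ) ^ 2 * ((d : ℝ) + 1)) ∧
      a 2 = ((d : ℝ) + 1 / 2) * zetaVal 2
          + ((d : ℝ) + 1 / 2) *
            ((((k : ℝ) ^ 2 - 5 * (k : ℝ) + 4) * (d : ℝ) ^ 3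
              + (2 * (k : ℝ) ^ 2 - 12 * (k : ℝ) + 8) * (d : ℝ) ^ 2
              + ((k : ℝ) ^ 2 - 7 * (k : ℝ) + 1) * (d : ℝ) - 2)
              / (2 * (d : ℝ) ^ 3 * ((d : ℝ) + 1) ^ 2)) ∧
      a 3 = ((d : ℝ) + 1 / 2) *
            (-2 * (d : ℝ) * zetaVal 3 + (k : ℝ) * zetaVal 2
              + (((k : ℝ) ^ 3 - 9 * (k : ℝ) ^ 2 + 14 * (k : ℝ)) * (d : ℝ) ^ 5
                + (3 * (k : ℝ) ^ 3 - 30 * (k : ℝ) ^ 2 + 45 * (k : ℝ) + 42) * (d : ℝ) ^ 4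
                + (3 * (k : ℝ) ^ 3 - 33 * (k : ℝ) ^ 2 + 39 * (k : ℝ) + 114) * (d : ℝ) ^ 3
                + ((k : ℝ) ^ 3 - 12 * (k : ℝ) ^ 2 + 2 * (k : ℝ) + 108) * (d : ℝ) ^ 2
                + (-6 * (k : ℝ) + 43) * (d : ℝ) + 6)
                / (6 * (d : ℝ) ^ 4 * ((d : ℝ) + 1) ^ 3))
          + (if k = 3 then ((d : ℝ) ^ 2 - 1 / 3) / (d : ℝ) ^ 3 else 0) ∧
      (k = 3 →
        a 3 = -(2 * (d : ℝ) + 1) * (d : ℝ) * zetaVal 3 + 3 * ((d : ℝ) + 1 / 2) * zetaVal 2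
          - (12 * (d : ℝ) ^ 6 - 50 * (d : ℝ) ^ 4 - 81 * (d : ℝ) ^ 3 - 71 * (d : ℝ) ^ 2
              - 33 * (d : ℝ) - 6) / (12 * (d : ℝ) ^ 4 * ((d : ℝ) + 1) ^ 3)) := by
  refine ⟨fun b hb => summable_irwinSet hd hb (by omega), ?_⟩
  -- With k = t + 3, the levels k - 1, k, k + 1 are t + 2, t + 3, t + 4; the names A, B, C below
  -- follow this order.
  obtain ⟨t, rfl⟩ := Nat.exists_eq_add_of_le' hk
  choose κ q hκ hΩ using fun l =>
    exists_hasInvPowExpansion_leadingDigits hd (show 1 ≤ t + 2 by omega) l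
  obtain ⟨p, hp, hcoeff⟩ := exists_hasInvPowExpansion_irwinSum hd (show 1 ≤ t + 2 by omega) hΩ
  obtain ⟨A0, A1, A2, A3⟩ := coeff_deviationSeries_one hd (t + 1)
  obtain ⟨B0, B1, B2, -⟩ := coeff_deviationSeries_one hd (t + 2)
  obtain ⟨C0, -⟩ := coeff_deviationSeries_one hd (t + 3)
  have A20 := coeff_zero_deviationSeries_of_two_le hd (t + 1) (m := 2) le_rfl
  have B20 := coeff_zero_deviationSeries_of_two_le hd (t + 2) (m := 2) le_rfl
  have A30 := coeff_zero_deviationSeries_of_two_le hd (t + 1) (m := 3) (by omega)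
  have A40 := coeff_zero_deviationSeries_of_two_le hd (t + 1) (m := 4) (by omega)
  have A21 := coeff_one_deviationSeries_two hd (t + 1)
  have B21 := coeff_one_deviationSeries_two hd (t + 2)
  have A22 := coeff_two_deviationSeries_two hd t
  -- Here level k - 2 = t + 1 enters, and the case distinction on t = 0 must be kept; it is the
  -- source of the exceptional term. At levels k - 1 and k the generic case applies.
  rw [coeff_one_deviationSeries_two hd t] at A22
  rw [if_neg (by omega)] at A21 B21
  have A31 := coeff_one_deviationSeries_three hd (t + 1)
  obtain ⟨κ0, κ1⟩ := coeff_col (hκ 0)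
  have τ0 := coeff_zero_zetaTailSeries one_ne_zero
  have τ1 := coeff_one_zetaTailSeries one_ne_zero
  have τ2 := coeff_two_zetaTailSeries one_ne_zero
  have σ0 := coeff_zero_zetaTailSeries two_ne_zero
  have hd0 : (d : ℝ) ≠ 0 := by exact_mod_cast hd.ne'
  have hd1 : (d : ℝ) + 1 ≠ 0 := by positivity
  have B30 := coeff_zero_deviationSeries_of_two_le hd (t + 2) (m := 3) (by omega)
  have a0 : PowerSeries.coeff 0 p = ((d : ℝ) + 1 / 2) / (d : ℝ) ^ 2 := by
    rw [hcoeff]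
    simp only [Finset.sum_range_one, coeff_zero_add_shifted, PowerSeries.coeff_zero_mul',
      coeff_cornerSeries, coeff_zero_negBinomSeries, zero_add, Nat.sub_self, A0]
    field_simp
  have a1 : PowerSeries.coeff 1 p = ((d : ℝ) + 1 / 2) *
      ((((t + 3 : ℕ) : ℝ) - 2) * (d : ℝ) + ((t + 3 : ℕ) : ℝ) - 3) /
      ((d : ℝ) ^ 2 * ((d : ℝ) + 1)) := by
    rw [hcoeff]
    simp only [Finset.sum_range_succ, Finset.range_zero, Finset.sum_empty, Nat.sub_self,
      Nat.sub_zero, zero_add, Nat.reduceAdd,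
      coeff_zero_add_shifted, coeff_one_add_shifted, PowerSeries.coeff_zero_mul',
      PowerSeries.coeff_one_mul', coeff_cornerSeries, coeff_rowSeries, coeff_zero_negBinomSeries,
      coeff_one_negBinomSeries, A0, A1, A20, B0, τ0]
    push_cast
    field_simp
    ring
  have a2 : PowerSeries.coeff 2 p = ((d : ℝ) + 1 / 2) * zetaVal 2 + ((d : ℝ) + 1 / 2) *
      (((((t + 3 : ℕ) : ℝ) ^ 2 - 5 * ((t + 3 : ℕ) : ℝ) + 4) * (d : ℝ) ^ 3
        + (2 * ((t + 3 : ℕ) : ℝ) ^ 2 - 12 * ((t + 3 : ℕ) : ℝ) + 8) * (d : ℝ) ^ 2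
        + (((t + 3 : ℕ) : ℝ) ^ 2 - 7 * ((t + 3 : ℕ) : ℝ) + 1) * (d : ℝ) - 2)
        / (2 * (d : ℝ) ^ 3 * ((d : ℝ) + 1) ^ 2)) := by
    rw [hcoeff]
    simp only [Finset.sum_range_succ, Finset.range_zero, Finset.sum_empty, Nat.sub_self,
      Nat.sub_zero, Nat.reduceSub, zero_add, Nat.reduceAdd, map_sub, PowerSeries.coeff_C_mul,
      coeff_zero_add_shifted, coeff_one_add_shifted, coeff_two_add_shifted,
      PowerSeries.coeff_zero_mul', PowerSeries.coeff_one_mul', PowerSeries.coeff_two_mul',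
      coeff_cornerSeries, coeff_rowSeries, coeff_zero_negBinomSeries, coeff_one_negBinomSeries,
      coeff_two_negBinomSeries, A0, A1, A2, A20, A21, A30, B0, B1, B20, τ0, τ1, κ0]
    push_cast
    field_simp
    ring
  have a3 : PowerSeries.coeff 3 p = ((d : ℝ) + 1 / 2) *
      (-2 * (d : ℝ) * zetaVal 3 + ((t + 3 : ℕ) : ℝ) * zetaVal 2
        + ((((t + 3 : ℕ) : ℝ) ^ 3 - 9 * ((t + 3 : ℕ) : ℝ) ^ 2 + 14 * ((t + 3 : ℕ) : ℝ)) * (d : ℝ) ^ 5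
          + (3 * ((t + 3 : ℕ) : ℝ) ^ 3 - 30 * ((t + 3 : ℕ) : ℝ) ^ 2
            + 45 * ((t + 3 : ℕ) : ℝ) + 42) * (d : ℝ) ^ 4
          + (3 * ((t + 3 : ℕ) : ℝ) ^ 3 - 33 * ((t + 3 : ℕ) : ℝ) ^ 2
            + 39 * ((t + 3 : ℕ) : ℝ) + 114) * (d : ℝ) ^ 3
          + (((t + 3 : ℕ) : ℝ) ^ 3 - 12 * ((t + 3 : ℕ) : ℝ) ^ 2
            + 2 * ((t + 3 : ℕ) : ℝ) + 108) * (d : ℝ) ^ 2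
          + (-6 * ((t + 3 : ℕ) : ℝ) + 43) * (d : ℝ) + 6)
          / (6 * (d : ℝ) ^ 4 * ((d : ℝ) + 1) ^ 3))
      + (if t + 3 = 3 then ((d : ℝ) ^ 2 - 1 / 3) / (d : ℝ) ^ 3 else 0) := by
    rw [hcoeff]
    simp only [Finset.sum_range_succ, Finset.range_zero, Finset.sum_empty, Nat.sub_self,
      Nat.sub_zero, Nat.reduceSub, zero_add, Nat.reduceAdd, map_sub, PowerSeries.coeff_C_mul,
      coeff_zero_add_shifted, coeff_one_add_shifted, coeff_two_add_shifted,
      coeff_three_add_shifted, PowerSeries.coeff_zero_mul', PowerSeries.coeff_one_mul',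
      PowerSeries.coeff_two_mul', PowerSeries.coeff_three_mul', coeff_cornerSeries,
      coeff_rowSeries, coeff_zero_negBinomSeries, coeff_one_negBinomSeries,
      coeff_two_negBinomSeries, coeff_three_negBinomSeries, A0, A1, A2, A3, A20, A21, A22, A30,
      A31, A40, B0, B1, B2, B20, B21, B30, C0, τ0, τ1, τ2, σ0, κ0, κ1]
    rcases eq_or_ne t 0 with rfl | ht
    · simp only [if_true]
      push_cast
      field_simp
      ring
    · rw [if_neg ht, if_neg (by omega)]
      push_cast
      field_simp
      ring
  -- Indexing starts at 0, so the coefficient of index n is the (n + 1)-st coefficient of the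
  -- expansion.
  refine ⟨fun n => PowerSeries.coeff n p, fun N => ?_, a0, a1, a2, a3, fun h3 => ?_⟩
  · exact hp.isBigO_sub_sum N
  · obtain rfl : t = 0 := by omega
    change PowerSeries.coeff 3 p = _
    rw [a3, if_pos rfl]
    push_cast
    field_simp
    ring
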